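/- **Setting.** Let $\mathfrak g$ be a finite-dimensional real semisimple Lie algebra, $\rho:\mathfrak g\to\mathfrak{gl}(V)$ a representation on a finite-dimensional real vector space, $\mathfrak g^{\mathbb C}=\mathfrak g\otimes_{\mathbb R}\mathbb C$ and $V^{\mathbb C}=V\otimes_{\mathbb R}\mathbb C$. Write $\sigma$, or a bar, for the complex conjugations (for an endomorphism $A$ of $V^{\mathbb C}$, $\overline A=\sigma A\sigma$), and extend $\rho$ to $\mathfrak g^{\mathbb C}$. Let $\mathfrak c$ be a Cartan subalgebra of $\mathfrak g$ (a maximal abelian subalgebra that is diagonalizable in $\mathfrak g^{\mathbb C}$), $R^+$ a positive system of roots of $\mathfrak c^{\mathbb C}$ in $\mathfrak g^{\mathbb C}$, and $\mathfrak y=\sum_{\alpha\in R^+}(\mathfrak g^{\mathbb C})_\alpha$. A high weight vector of weight $\lambda$ is a nonzero $v\in V^{\mathbb C}$ with $\mathfrak y v=0$ and $Hv=\lambda(H)v$ for $H\in\mathfrak c^{\mathbb C}$. For $\lambda\in(\mathfrak c^{\mathbb C})^*$ put $\lambda^\sigma(H)=\overline{\lambda(\sigma H)}$ and $p(\alpha)=\alpha^\sigma$.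 For every simple root $\alpha$ choose $X_{\pm\alpha}\in(\mathfrak g^{\mathbb C})_{\pm\alpha}$ and $H_\alpha\in\mathfrak c^{\mathbb C}$, $H_\alpha\neq0$, with $[X_\alpha,X_{-\alpha}]=H_\alpha$ and $[H_\alpha,X_{\pm\alpha}]=\pm2X_{\pm\alpha}$. Let $w_\alpha(\mu)=\mu-\mu(H_\alpha)\alpha$ on $(\mathfrak c^{\mathbb C})^*$ and $w_{\alpha,\rho}=e^{\rho(X_\alpha)}e^{-\rho(X_{-\alpha})}e^{\rho(X_\alpha)}\in GL(V^{\mathbb C})$. Let $\beta_1,\dots,\beta_l$ be simple roots such that $p\,w_{\beta_1}\cdots w_{\beta_j}(\beta_{j+1})$ is negative for $0\le j<l$ and $p\,w_{\beta_1}\cdots w_{\beta_l}(R^+)=R^+$. Put $\omega=w_{\beta_1}\cdots w_{\beta_l}$, $\omega_\rho=w_{\beta_1,\rho}\cdots w_{\beta_l,\rho}$ and $\Theta(\lambda)=\omega^{-1}\lambda^\sigma$. Let $G_\rho\subset GL(V)$ be the subgroup generated by all $e^{\rho(X)}$, $X\in\mathfrak g$; for $u\in V$ let $\langle G_\rho u\rangle$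 be the real span of its orbit. **Lemma.** Let $M\subset V^{\mathbb C}$ be an irreducible $\mathfrak g^{\mathbb C}$-invariant subspace with highest weight vector $v$ of weight $\lambda$. 1. $M\cap\overline M=0$ if and only if $v\wedge\omega_\rho^{-1}\overline v\neq0$. Moreover $\overline M$ is irreducible with highest weight vector $\omega_\rho^{-1}\overline v$, of weight $\Theta(\lambda)$. 2. Suppose that $v\wedge\omega_\rho^{-1}\overline v\ne0$ and $\Theta(\lambda)=\lambda$. Then $M+\overline M$ is a direct sum. Let $W\subset V$ be the space of its real points. The $\mathfrak g$-module $W$ is either irreducible or the direct sum of two isomorphic irreducible submodules. There is a nonzero real number $d$ with $\omega_\rho^{-1}\,\overline{\omega_\rho^{-1}}\,v=d\,v$; equivalently, there are $\mathfrak g^{\mathbb C}$-linear maps $M\to\overline M\to M$ with $v\mapsto\omega_\rho^{-1}\overline v\mapsto\omega_\rho^{-1}\overline{\omega_\rho^{-1}}v$, whose composite is $d$ times the identity of $M$. * If $d>0$, put $v_1=v+\tfrac1{\sqrt d}\,\omega_\rho^{-1}\overline v$ and $v_2=v-\tfrac1{\sqrt d}\,\omega_\rho^{-1}\overline v$. Then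 $W=B_1\oplus B_2$ with isomorphic irreducible $\mathfrak g$-submodules $B_1=\langle G_\rho\operatorname{Re}v_1\rangle$ and $B_2=\langle G_\rho\operatorname{Im}v_2\rangle$. Also $B_1=\langle G_\rho\operatorname{Im}v_1\rangle$ if $\operatorname{Im}v_1\ne0$, and $B_2=\langle G_\rho\operatorname{Re}v_2\rangle$ if $\operatorname{Re}v_2\neq0$. * If $d<0$, then $W$ is irreducible. -/

import Mathlib

open scoped TensorProduct

namespace RealRep

/-! ### Exponentials of endomorphisms of finite-dimensional spaces -/

section Exponential

variable {𝕜 : Type*} [RCLike 𝕜] {E : Type*} [AddCommGroup E] [Module 𝕜 E] [FiniteDimensional 𝕜 E]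

theorem exp_mul_exp_neg {ι : Type*} [Fintype ι] [DecidableEq ι] (A : Matrix ι ι 𝕜) :
    NormedSpace.exp A * NormedSpace.exp (-A) = 1 := by
  have h : Commute A (-A) := by simp [Commute, SemiconjBy]
  rw [← Matrix.exp_add_of_commute _ _ h, add_neg_cancel, NormedSpace.exp_zero]

/-- The exponential `e^f` of an endomorphism of a finite-dimensional space, as an invertible
endomorphism with inverse `e^{-f}`. It is computed on matrices in some basis (the result does not
depend on the basis, as the matrix exponential commutes with conjugation). -/
noncomputable def expEnd (f : Module.End 𝕜 E) : (Module.End 𝕜 E)ˣ :=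
  Units.map
    (LinearMap.toMatrixAlgEquiv (Module.finBasis 𝕜 E)).symm.toRingEquiv.toMonoidHom
    { val := NormedSpace.exp (LinearMap.toMatrixAlgEquiv (Module.finBasis 𝕜 E) f)
      inv := NormedSpace.exp (-LinearMap.toMatrixAlgEquiv (Module.finBasis 𝕜 E) f)
      val_inv := exp_mul_exp_neg _
      inv_val := by
        simpa using exp_mul_exp_neg (-LinearMap.toMatrixAlgEquiv (Module.finBasis 𝕜 E) f) }

end Exponential

/-! ### Complexification and conjugation -/

section Conjugation

variable {V : Type*} [AddCommGroup V] [Module ℝ V]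

/-- The conjugation `σ(z ⊗ w) = z̄ ⊗ w` of the complexification `V^ℂ = ℂ ⊗ V`. -/
noncomputable def conj : (ℂ ⊗[ℝ] V) →ₛₗ[starRingEnd ℂ] (ℂ ⊗[ℝ] V) where
  toFun := LinearMap.rTensor V Complex.conjAe.toLinearMap
  map_add' := map_add _
  map_smul' c x := by
    induction x using TensorProduct.induction_on with
    | zero => simp
    | tmul z w => simp [TensorProduct.smul_tmul']
    | add x y hx hy => simp only [smul_add, map_add, hx, hy]

theorem conj_tmul (z : ℂ) (w : V) : conj (z ⊗ₜ[ℝ] w) = (starRingEnd ℂ z) ⊗ₜ[ℝ] w := rfl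

/-- The conjugate `σ ∘ A ∘ σ` of a complex-linear endomorphism of `V^ℂ`. -/
noncomputable def conjEnd (A : Module.End ℂ (ℂ ⊗[ℝ] V)) : Module.End ℂ (ℂ ⊗[ℝ] V) :=
  (conj (V := V)).comp (A.comp (conj (V := V)))

/-- The real part of a vector of `V^ℂ = V ⊕ iV`. -/
noncomputable def rePart : (ℂ ⊗[ℝ] V) →ₗ[ℝ] V :=
  (TensorProduct.lid ℝ V).toLinearMap ∘ₗ LinearMap.rTensor V Complex.reLm

/-- The imaginary part of a vector of `V^ℂ = V ⊕ iV`. -/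
noncomputable def imPart : (ℂ ⊗[ℝ] V) →ₗ[ℝ] V :=
  (TensorProduct.lid ℝ V).toLinearMap ∘ₗ LinearMap.rTensor V Complex.imLm

variable {𝔤 : Type*} [LieRing 𝔤] [LieAlgebra ℝ 𝔤] [LieRingModule 𝔤 V] [LieModule ℝ 𝔤 V]

/-- The action of `x ∈ 𝔤^ℂ` on `V^ℂ`, i.e. `ρ^ℂ(x)`. -/
noncomputable abbrev act (x : ℂ ⊗[ℝ] 𝔤) : Module.End ℂ (ℂ ⊗[ℝ] V) :=
  LieModule.toEnd ℂ (ℂ ⊗[ℝ] 𝔤) (ℂ ⊗[ℝ] V) x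

theorem conj_act (x : ℂ ⊗[ℝ] 𝔤) (m : ℂ ⊗[ℝ] V) : conj (act x m) = act (conj x) (conj m) := by
  induction x using TensorProduct.induction_on with
  | zero => simp only [act, map_zero, LinearMap.zero_apply]
  | tmul z a =>
    induction m using TensorProduct.induction_on with
    | zero => simp only [map_zero]
    | tmul w b => simp [act, conj_tmul]
    | add m n hm hn => simp only [map_add, hm, hn]
  | add x y hx hy => simp only [act, map_add, LinearMap.add_apply] at *; rw [hx, hy]

theorem conj_conj (m : ℂ ⊗[ℝ] V) : conj (conj m) = m := by
  induction m using TensorProduct.induction_on with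
  | zero => simp
  | tmul w b => simp [conj_tmul]
  | add m n hm hn => simp only [map_add, hm, hn]

/-- The conjugate `M̄ = σ(M)` of a `𝔤^ℂ`-invariant subspace `M` of `V^ℂ`. -/
noncomputable def conjSub (M : LieSubmodule ℂ (ℂ ⊗[ℝ] 𝔤) (ℂ ⊗[ℝ] V)) :
    LieSubmodule ℂ (ℂ ⊗[ℝ] 𝔤) (ℂ ⊗[ℝ] V) where
  toSubmodule := M.toSubmodule.map (conj (V := V))
  lie_mem := by
    rintro x _ ⟨m, hm, rfl⟩
    refine ⟨act (conj x) m, M.lie_mem hm, ?_⟩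
    rw [conj_act, conj_conj]
    rfl

/-- The real points of a `𝔤^ℂ`-invariant subspace `N` of `V^ℂ`, as a `𝔤`-submodule of `V`
(where `V` is identified with the real points `1 ⊗ V` of `V^ℂ`). -/
def realPoints (N : LieSubmodule ℂ (ℂ ⊗[ℝ] 𝔤) (ℂ ⊗[ℝ] V)) : LieSubmodule ℝ 𝔤 V where
  carrier := {w | (1 : ℂ) ⊗ₜ[ℝ] w ∈ N}
  add_mem' {a b} ha hb := by
    simp only [Set.mem_ofPred_eq, TensorProduct.tmul_add] at *
    exact add_mem ha hb
  zero_mem' := by simp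
  smul_mem' c w hw := by
    have h : (1 : ℂ) ⊗ₜ[ℝ] (c • w) = (c : ℂ) • ((1 : ℂ) ⊗ₜ[ℝ] w) := by
      rw [TensorProduct.smul_tmul', TensorProduct.tmul_smul, TensorProduct.smul_tmul']
      simp
    simp only [Set.mem_ofPred_eq, h] at *
    exact N.smul_mem _ hw
  lie_mem {x w} hw := by
    have h : (1 : ℂ) ⊗ₜ[ℝ] ⁅x, w⁆ = ⁅(1 : ℂ) ⊗ₜ[ℝ] x, (1 : ℂ) ⊗ₜ[ℝ] w⁆ := by simp
    change (1 : ℂ) ⊗ₜ[ℝ] ⁅x, w⁆ ∈ N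
    rw [h]
    exact N.lie_mem hw

/-- `v ∧ w`, in the exterior algebra of a complex vector space. -/
noncomputable def wedge {E : Type*} [AddCommGroup E] [Module ℂ E] (v w : E) :
    ExteriorAlgebra ℂ E :=
  ExteriorAlgebra.ι ℂ v * ExteriorAlgebra.ι ℂ w

/-- The group `G_ρ`: the subgroup of `GL(V)` generated by the exponentials `e^{ρ(X)}`, `X ∈ 𝔤`. -/
noncomputable def realGroup (𝔤 V : Type*) [LieRing 𝔤] [LieAlgebra ℝ 𝔤] [AddCommGroup V]
    [Module ℝ V] [FiniteDimensional ℝ V] [LieRingModule 𝔤 V] [LieModule ℝ 𝔤 V] :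
    Subgroup (Module.End ℝ V)ˣ :=
  Subgroup.closure (Set.range fun X : 𝔤 => expEnd (LieModule.toEnd ℝ 𝔤 V X))

/-- The real linear span `⟨G_ρ u⟩` of the orbit of `u`. -/
noncomputable def orbitSpan (𝔤 : Type*) {V : Type*} [LieRing 𝔤] [LieAlgebra ℝ 𝔤] [AddCommGroup V]
    [Module ℝ V] [FiniteDimensional ℝ V] [LieRingModule 𝔤 V] [LieModule ℝ 𝔤 V] (u : V) :
    Submodule ℝ V :=
  Submodule.span ℝ {w | ∃ g ∈ realGroup 𝔤 V, w = (g : Module.End ℝ V) u}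

end Conjugation

/-! ### Cartan subalgebras, roots, weights -/

section Roots

variable {𝔤 : Type*} [LieRing 𝔤] [LieAlgebra ℝ 𝔤]

/-- A Cartan subalgebra of the (semisimple) real Lie algebra `𝔤`: a maximal abelian subalgebra which
is diagonalizable in the complexification of `𝔤`. -/
structure IsCartan (𝔠 : LieSubalgebra ℝ 𝔤) : Prop where
  maximal_abelian : Maximal (fun 𝔞 : LieSubalgebra ℝ 𝔤 => IsLieAbelian 𝔞) 𝔠
  diagonalizable : ∀ h ∈ 𝔠, ⨆ z : ℂ,
    Module.End.eigenspace (LieAlgebra.ad ℂ (ℂ ⊗[ℝ] 𝔤) ((1 : ℂ) ⊗ₜ[ℝ] h)) z = ⊤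

variable (𝔠 : LieSubalgebra ℝ 𝔤)

/-- Complex linear functions on `𝔠^ℂ`. -/
abbrev Weight : Type _ := Module.Dual ℂ (ℂ ⊗[ℝ] 𝔠)

/-- The inclusion `𝔠^ℂ → 𝔤^ℂ`. -/
noncomputable def cartanIncl : (ℂ ⊗[ℝ] 𝔠) →ₗ[ℂ] (ℂ ⊗[ℝ] 𝔤) :=
  LinearMap.baseChange ℂ (𝔠.incl : 𝔠 →ₗ[ℝ] 𝔤)

/-- The root space `(𝔤^ℂ)_α`. -/
noncomputable def rootSpace (α : Weight 𝔠) : Submodule ℂ (ℂ ⊗[ℝ] 𝔤) where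
  carrier := {X | ∀ H : ℂ ⊗[ℝ] 𝔠, LieAlgebra.ad ℂ (ℂ ⊗[ℝ] 𝔤) (cartanIncl 𝔠 H) X = α H • X}
  add_mem' {X Y} hX hY H := by rw [map_add, hX H, hY H, smul_add]
  zero_mem' H := by rw [map_zero, smul_zero]
  smul_mem' c X hX H := by rw [map_smul, hX H, smul_comm]

/-- The set `R` of roots of `𝔠^ℂ` in `𝔤^ℂ`. -/
def roots : Set (Weight 𝔠) := {α | α ≠ 0 ∧ rootSpace 𝔠 α ≠ ⊥}

/-- `P` is a positive system of roots: the set of roots on which some real linear functional, not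
vanishing on any root, is positive. These are the sets of roots `R⁺` of the Borel subalgebras
containing `𝔠^ℂ`. -/
def IsPositiveSystem (P : Set (Weight 𝔠)) : Prop :=
  ∃ f : Weight 𝔠 →ₗ[ℝ] ℝ, (∀ α ∈ roots 𝔠, f α ≠ 0) ∧ P = {α ∈ roots 𝔠 | 0 < f α}

variable {𝔠}

/-- A simple root: a positive root which is not a sum of two positive roots. -/
def IsSimpleRoot (P : Set (Weight 𝔠)) (α : Weight 𝔠) : Prop :=
  α ∈ P ∧ ∀ β ∈ P, ∀ γ ∈ P, α ≠ β + γ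

/-- The nilradical `𝔶 = ∑_{α > 0} (𝔤^ℂ)_α` of the Borel subalgebra. -/
noncomputable def nilradical (P : Set (Weight 𝔠)) : Submodule ℂ (ℂ ⊗[ℝ] 𝔤) :=
  ⨆ α ∈ P, rootSpace 𝔠 α

/-- The conjugate `μ^σ(H) = conj (μ (σ H))` of a complex linear function on `𝔠^ℂ`. -/
noncomputable def conjWeight (μ : Weight 𝔠) : Weight 𝔠 where
  toFun H := starRingEnd ℂ (μ (conj H))
  map_add' := by simp
  map_smul' := by simp

/-- A high weight vector of weight `μ` relative to the pair `(𝔶, 𝔠^ℂ)`. -/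
structure IsHighWeightVector {V : Type*} [AddCommGroup V] [Module ℝ V] [LieRingModule 𝔤 V]
    [LieModule ℝ 𝔤 V] (P : Set (Weight 𝔠)) (μ : Weight 𝔠) (v : ℂ ⊗[ℝ] V) : Prop where
  ne_zero : v ≠ 0
  nil : ∀ n ∈ nilradical P, act n v = 0
  weight : ∀ H : ℂ ⊗[ℝ] 𝔠, act (cartanIncl 𝔠 H) v = μ H • v

/-- A choice, for every simple root `α`, of a standard copy of `𝔰𝔩(2, ℂ)`, with generators
`X α ∈ (𝔤^ℂ)_α`, `Y α = X_{-α} ∈ (𝔤^ℂ)_{-α}` and `H α ∈ 𝔠^ℂ`, satisfying `[X, Y] = H`,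
`[H, X] = 2 X`, `[H, Y] = -2 Y`. -/
structure StandardTriples (P : Set (Weight 𝔠)) where
  X : Weight 𝔠 → ℂ ⊗[ℝ] 𝔤
  Y : Weight 𝔠 → ℂ ⊗[ℝ] 𝔤
  H : Weight 𝔠 → ℂ ⊗[ℝ] 𝔠
  X_mem : ∀ α, IsSimpleRoot P α → X α ∈ rootSpace 𝔠 α
  Y_mem : ∀ α, IsSimpleRoot P α → Y α ∈ rootSpace 𝔠 (-α)
  triple : ∀ α, IsSimpleRoot P α → IsSl2Triple (cartanIncl 𝔠 (H α)) (X α) (Y α)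

namespace StandardTriples

variable {P : Set (Weight 𝔠)} (T : StandardTriples P)

/-- The involution `w_α` of the Weyl group, acting on linear functions on `𝔠^ℂ`. -/
noncomputable def refl (α μ : Weight 𝔠) : Weight 𝔠 := μ - μ (T.H α) • α

/-- The action of `w_{β₁} ⋯ w_{βₗ}` on linear functions on `𝔠^ℂ`. -/
noncomputable def weyl (β : List (Weight 𝔠)) (μ : Weight 𝔠) : Weight 𝔠 := β.foldr T.refl μ

/-- The word `w_{β₁} ⋯ w_{βₗ}` in the simple reflections is one that is produced by the following
procedure, where `p(α) = α^σ`: as long as `p w_{β₁} ⋯ w_{βⱼ}` maps some simple root to a negative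
root, let `β_{j+1}` be such a simple root; stop when `p w_{β₁} ⋯ w_{βₗ}` preserves the positive
system. -/
structure IsConjWord (β : List (Weight 𝔠)) : Prop where
  simple : ∀ α ∈ β, IsSimpleRoot P α
  step : ∀ (β₁ : List (Weight 𝔠)) (α : Weight 𝔠) (β₂ : List (Weight 𝔠)), β = β₁ ++ α :: β₂ →
    -conjWeight (T.weyl β₁ α) ∈ P
  terminal : (fun α => conjWeight (T.weyl β α)) '' P = P

/-- `Θ(μ) = ω⁻¹ μ^σ`, where `ω = w_{β₁} ⋯ w_{βₗ}`, so that `ω⁻¹` acts as `w_{βₗ} ⋯ w_{β₁}`. -/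
noncomputable def theta (β : List (Weight 𝔠)) (μ : Weight 𝔠) : Weight 𝔠 :=
  T.weyl β.reverse (conjWeight μ)

variable (V : Type*) [AddCommGroup V] [Module ℝ V] [FiniteDimensional ℝ V] [LieRingModule 𝔤 V]
  [LieModule ℝ 𝔤 V]

/-- `w_{α,ρ} = e^{ρ(X_α)} e^{-ρ(X_{-α})} e^{ρ(X_α)}`, an element of `GL(V^ℂ)`. -/
noncomputable def wRep (α : Weight 𝔠) : (Module.End ℂ (ℂ ⊗[ℝ] V))ˣ :=
  expEnd (act (T.X α)) *
    expEnd (-act (T.Y α)) *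
    expEnd (act (T.X α))

/-- `ω_ρ = w_{β₁,ρ} ⋯ w_{βₗ,ρ}`. -/
noncomputable def omegaRep (β : List (Weight 𝔠)) : (Module.End ℂ (ℂ ⊗[ℝ] V))ˣ :=
  (β.map (T.wRep V)).prod

/-- `ω_ρ⁻¹`, as an endomorphism of `V^ℂ`. -/
noncomputable def omegaInv (β : List (Weight 𝔠)) : Module.End ℂ (ℂ ⊗[ℝ] V) :=
  ((T.omegaRep V β)⁻¹ : (Module.End ℂ (ℂ ⊗[ℝ] V))ˣ)

end StandardTriples

end Roots

end RealRep

open RealRep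

open scoped TensorProduct

/-! Everything rests on the antilinear map `S m = ω_ρ⁻¹ m̄` of `V^ℂ`. Conjugation turns the action
of `x` into that of `x̄`, and `ω_ρ` is compatible with an automorphism of `𝔤^ℂ` carrying the root
space of `α` to that of `ω α` (`lie_omegaInv`, `omegaAd_mem_rootSpace`). Since `p ω` preserves the
positive roots, `S` sends high weight vectors of weight `μ` to high weight vectors of weight `Θ(μ)`
(`IsHighWeightVector.omegaInv_conj`). Since `ω_ρ` preserves invariant subspaces, `S` maps each
invariant `N` into `N̄`. High weight vectors of an irreducible module are proportional, so `M` and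
`M̄` meet in 0 exactly when `v` and `S v` are independent.

Suppose now that `u = S v` is independent of `v` and `Θ(μ) = μ`. The module generated by `v + u`
meets `M` and `M̄` trivially, hence is the graph of an isomorphism `M → M̄` with `v ↦ u`. By
proportionality `S² v = c v`, and `S²(v + u) = c v + c̄ u` stays in the graph, so `c = d` is real.

If `d > 0`, then `v₁` and `v₂` are eigenvectors of `S` with eigenvalues `±√d`. Each generates a
conjugation-stable irreducible module, and the real points of these are `B₁` and `B₂`. The module
generated by `v₁ + i v₂` is conjugation-stable too, and its real points are the graph of an
isomorphism `B₁ ≅ B₂`. If `d < 0`, a proper nonzero conjugation-stable submodule would contain some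
`v + c u`, and applying `S` would give `|c|² d = 1`.

The orbit spans require `Re v₁ ≠ 0` and `Im v₂ ≠ 0`. Otherwise `v̄` is a negative multiple of `u`;
then `ω μ = μ`, so `μ` is orthogonal to every letter of the word, `ω_ρ` fixes `v̄`, and `u = v̄`, a
contradiction. -/

namespace RealRep

/-! ### Exponentials of endomorphisms through the power series -/

section Exponential

open scoped Nat

variable {𝕜 : Type*} [RCLike 𝕜] {E : Type*} [AddCommGroup E] [Module 𝕜 E] [FiniteDimensional 𝕜 E]
  {F : Type*} [AddCommGroup F] [Module 𝕜 F] [FiniteDimensional 𝕜 F]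

theorem coe_expEnd (f : Module.End 𝕜 E) :
    (expEnd f : Module.End 𝕜 E) = (LinearMap.toMatrixAlgEquiv (Module.finBasis 𝕜 E)).symm
      (NormedSpace.exp (LinearMap.toMatrixAlgEquiv (Module.finBasis 𝕜 E) f)) := rfl

theorem hasSum_matrix_exp {ι : Type*} [Fintype ι] [DecidableEq ι] (A : Matrix ι ι 𝕜) :
    HasSum (fun n : ℕ => (n ! : 𝕜)⁻¹ • A ^ n) (NormedSpace.exp A) := by
  open scoped Matrix.Norms.Operator in
  exact NormedSpace.exp_series_hasSum_exp' (𝕂 := 𝕜) A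

/-- The exponential series, tested on a vector and a linear functional. -/
theorem hasSum_expEnd (f : Module.End 𝕜 E) (v : E) (l : E →ₗ[𝕜] 𝕜) :
    HasSum (fun n : ℕ => (n ! : 𝕜)⁻¹ • l ((f ^ n) v)) (l ((expEnd f : Module.End 𝕜 E) v)) := by
  set e := LinearMap.toMatrixAlgEquiv (Module.finBasis 𝕜 E)
  let Φ : Matrix _ _ 𝕜 →ₗ[𝕜] 𝕜 :=
    (l ∘ₗ LinearMap.applyₗ v) ∘ₗ (e.symm.toLinearEquiv.toLinearMap)
  have hΦ : Continuous Φ := LinearMap.continuous_of_finiteDimensional Φ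
  have h := (hasSum_matrix_exp (e f)).map Φ hΦ
  have h2 : (Φ ∘ fun n : ℕ => (n ! : 𝕜)⁻¹ • e f ^ n)
      = fun n : ℕ => (n ! : 𝕜)⁻¹ • l ((f ^ n) v) := by
    funext n
    simp [Φ, ← map_pow]
  rw [h2] at h
  exact h

theorem eq_of_forall_dual {x y : E} (h : ∀ l : E →ₗ[𝕜] 𝕜, l x = l y) : x = y := by
  rw [← sub_eq_zero]
  refine (Module.forall_dual_apply_eq_zero_iff 𝕜 _).1 fun l => ?_
  rw [map_sub, h, sub_self]

/-- The intertwining passes to powers, so the two exponential series agree term by term after a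
functional is applied. -/
theorem intertwine_expEnd {f : Module.End 𝕜 E} {g : Module.End 𝕜 F} (l : E →ₗ[𝕜] F)
    (h : ∀ x, l (f x) = g (l x)) (x : E) :
    l ((expEnd f : Module.End 𝕜 E) x) = (expEnd g : Module.End 𝕜 F) (l x) := by
  refine eq_of_forall_dual (𝕜 := 𝕜) fun k => ?_
  have h1 := hasSum_expEnd f x (k ∘ₗ l)
  have h2 := hasSum_expEnd g (l x) k
  have h3 : ∀ n : ℕ, l ((f ^ n) x) = (g ^ n) (l x) := by
    intro n
    induction n with
    | zero => rfl
    | succ n ih => rw [pow_succ', pow_succ', Module.End.mul_apply, Module.End.mul_apply, h, ih]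
  simp only [LinearMap.comp_apply, h3] at h1
  exact h1.unique h2

theorem expEnd_mem {f : Module.End 𝕜 E} {N : Submodule 𝕜 E} (h : ∀ x ∈ N, f x ∈ N) {x : E}
    (hx : x ∈ N) : (expEnd f : Module.End 𝕜 E) x ∈ N := by
  have := intertwine_expEnd (f := f.restrict h) (g := f) N.subtype (fun _ => rfl) ⟨x, hx⟩
  rw [Submodule.subtype_apply] at this
  rw [Submodule.subtype_apply] at this
  rw [← this]
  exact Submodule.coe_mem _

theorem expEnd_add_of_commute {f g : Module.End 𝕜 E} (h : Commute f g) :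
    expEnd (f + g) = expEnd f * expEnd g := by
  refine Units.ext ?_
  rw [Units.val_mul, coe_expEnd, coe_expEnd, coe_expEnd, ← map_mul, map_add,
    Matrix.exp_add_of_commute]
  exact h.map (LinearMap.toMatrixAlgEquiv (Module.finBasis 𝕜 E))

theorem expEnd_zero : expEnd (0 : Module.End 𝕜 E) = 1 := by
  refine Units.ext ?_
  rw [coe_expEnd, map_zero, NormedSpace.exp_zero, map_one, Units.val_one]

theorem expEnd_neg (f : Module.End 𝕜 E) : expEnd (-f) = (expEnd f)⁻¹ := by
  rw [eq_inv_iff_mul_eq_one, ← expEnd_add_of_commute (Commute.neg_left (Commute.refl f)), neg_add_cancel,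
    expEnd_zero]

theorem expEnd_apply_of_pow_eq_zero {f : Module.End 𝕜 E} {v : E} {k : ℕ} (h : (f ^ k) v = 0) :
    (expEnd f : Module.End 𝕜 E) v = ∑ n ∈ Finset.range k, (n ! : 𝕜)⁻¹ • (f ^ n) v := by
  refine eq_of_forall_dual (𝕜 := 𝕜) fun l => ?_
  have h1 := hasSum_expEnd f v l
  refine h1.unique ?_
  have h2 : l (∑ n ∈ Finset.range k, (n ! : 𝕜)⁻¹ • (f ^ n) v)
      = ∑ n ∈ Finset.range k, (n ! : 𝕜)⁻¹ • l ((f ^ n) v) := by simp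
  rw [h2]
  refine hasSum_sum_of_ne_finset_zero fun n hn => ?_
  obtain ⟨m, rfl⟩ := Nat.exists_eq_add_of_le (not_lt.1 (fun h' => hn (Finset.mem_range.2 h')))
  rw [add_comm, pow_add, Module.End.mul_apply, h, map_zero, map_zero, smul_zero]

theorem expEnd_apply_of_apply_eq_zero {f : Module.End 𝕜 E} {v : E} (h : f v = 0) :
    (expEnd f : Module.End 𝕜 E) v = v := by
  rw [expEnd_apply_of_pow_eq_zero (k := 1) (by simpa using h)]
  simp

/-- If `l (e^{t f} v) = 0` for all real `t`, then `l (f v) = 0`. -/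
theorem apply_eq_zero_of_expEnd {E : Type*} [AddCommGroup E] [Module ℝ E] [FiniteDimensional ℝ E]
    {f : Module.End ℝ E} {v : E} {l : E →ₗ[ℝ] ℝ}
    (h : ∀ t : ℝ, l ((expEnd (t • f) : Module.End ℝ E) v) = 0) : l (f v) = 0 := by
  set e := LinearMap.toMatrixAlgEquiv (Module.finBasis ℝ E)
  let Φ : Matrix _ _ ℝ →ₗ[ℝ] ℝ :=
    (l ∘ₗ LinearMap.applyₗ v) ∘ₗ (e.symm.toLinearEquiv.toLinearMap)
  have hd : HasDerivAt (fun t : ℝ => Φ (NormedSpace.exp (t • e f))) (Φ (e f)) 0 := by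
    open scoped Matrix.Norms.Operator in
    have h1 := hasDerivAt_exp_smul_const (𝕂 := ℝ) (e f) (0 : ℝ)
    rw [zero_smul, NormedSpace.exp_zero, one_mul] at h1
    exact (LinearMap.toContinuousLinearMap Φ).hasFDerivAt.comp_hasDerivAt _ h1
  have h0 : (fun t : ℝ => Φ (NormedSpace.exp (t • e f))) = fun _ => 0 := by
    funext t
    rw [← map_smul]
    exact h t
  rw [h0] at hd
  have h2 := hd.unique (hasDerivAt_const (0 : ℝ) (0 : ℝ))
  simpa [Φ] using h2

/-- The exponential of an operator acting as a derivation on a bilinear pairing. -/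
theorem expEnd_leibniz {G : Type*} [AddCommGroup G] [Module 𝕜 G] [FiniteDimensional 𝕜 G]
    (B : E →ₗ[𝕜] F →ₗ[𝕜] G) {a : Module.End 𝕜 E} {b : Module.End 𝕜 F} {c : Module.End 𝕜 G}
    (h : ∀ x y, c (B x y) = B (a x) y + B x (b y)) (x : E) (y : F) :
    (expEnd c : Module.End 𝕜 G) (B x y)
      = B ((expEnd a : Module.End 𝕜 E) x) ((expEnd b : Module.End 𝕜 F) y) := by
  -- The derivation rule says that `B` intertwines `a ⊗ 1 + 1 ⊗ b` with `c`. The two summands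
  -- commute, so the exponential of their sum is `e^a ⊗ e^b`.
  have h1 := intertwine_expEnd (f := a.rTensor F + b.lTensor E) (g := c) (TensorProduct.lift B)
    (fun t => by
      induction t using TensorProduct.induction_on with
      | zero => simp
      | tmul x y => simp [h]
      | add s t hs ht => simp only [map_add, hs, ht]) (x ⊗ₜ y)
  have hc : Commute (a.rTensor F) (b.lTensor E) := by
    refine TensorProduct.ext' fun x y => ?_
    simp
  rw [TensorProduct.lift.tmul] at h1
  rw [← h1, expEnd_add_of_commute hc, Units.val_mul, Module.End.mul_apply]
  have h2 := intertwine_expEnd (f := b) (g := b.lTensor E) (TensorProduct.mk 𝕜 E F x)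
    (fun y => by simp) y
  rw [TensorProduct.mk_apply, TensorProduct.mk_apply] at h2
  rw [← h2]
  have h3 := intertwine_expEnd (f := a) (g := a.rTensor F)
    ((TensorProduct.mk 𝕜 E F).flip ((expEnd b : Module.End 𝕜 F) y)) (fun y => by simp) x
  rw [LinearMap.flip_apply, LinearMap.flip_apply, TensorProduct.mk_apply,
    TensorProduct.mk_apply] at h3
  rw [← h3, TensorProduct.lift.tmul]

end Exponential

/-! ### Irreducible submodules, and submodules that are graphs -/

section LieSubmodules

variable {R L E : Type*} [CommRing R] [LieRing L] [AddCommGroup E] [Module R E]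
  [LieRingModule L E]

theorem isIrreducible_iff [LieAlgebra R L] [LieModule R L E] {M : LieSubmodule R L E} :
    LieModule.IsIrreducible R L M ↔ M ≠ ⊥ ∧ ∀ N ≤ M, N ≠ ⊥ → N = M := by
  constructor
  · intro h
    refine ⟨?_, fun N hN hN0 => ?_⟩
    · rintro rfl
      obtain ⟨a, b, hab⟩ := (h.toNontrivial : Nontrivial (LieSubmodule R L (⊥ : LieSubmodule R L E)))
      exact hab (Subsingleton.elim _ _)
    · rcases h.eq_bot_or_eq_top (N.comap M.incl) with h1 | h1
      · rw [LieSubmodule.comap_incl_eq_bot, inf_eq_right.2 hN] at h1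
        exact absurd h1 hN0
      · exact le_antisymm hN (LieSubmodule.comap_incl_eq_top.1 h1)
  · rintro ⟨h0, h⟩
    have : Nontrivial M := (LieSubmodule.nontrivial_iff_ne_bot R L E).2 h0
    refine LieModule.IsIrreducible.mk fun N hN => ?_
    have h1 : N.map M.incl ≤ M := LieSubmodule.map_incl_le
    have h2 : N.map M.incl ≠ ⊥ := by
      intro h2
      refine hN ((LieSubmodule.eq_bot_iff N).2 fun x hx => Subtype.ext ?_)
      exact (LieSubmodule.mem_bot _).1 (h2 ▸ LieSubmodule.mem_map_of_mem hx)
    have h3 := h _ h1 h2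
    refine eq_top_iff.2 fun x _ => ?_
    have h4 : (x : E) ∈ N.map M.incl := h3.symm.le x.2
    obtain ⟨y, hy, hyx⟩ := LieSubmodule.mem_map _ |>.1 h4
    rwa [← Subtype.ext (a1 := y) (a2 := x) hyx]

/-- The elements of `M₁` which are congruent to an element of `M₂` modulo `K`. -/
def correspondent (K M₁ M₂ : LieSubmodule R L E) : LieSubmodule R L E where
  carrier := {x | x ∈ M₁ ∧ ∃ y ∈ M₂, x + y ∈ K}
  add_mem' := by
    rintro a b ⟨ha, y, hy, hay⟩ ⟨hb, z, hz, hbz⟩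
    refine ⟨add_mem ha hb, y + z, add_mem hy hz, ?_⟩
    rw [add_add_add_comm]
    exact add_mem hay hbz
  zero_mem' := ⟨zero_mem _, 0, zero_mem _, by rw [add_zero]; exact zero_mem _⟩
  smul_mem' := by
    rintro c a ⟨ha, y, hy, hay⟩
    refine ⟨M₁.smul_mem c ha, c • y, M₂.smul_mem c hy, ?_⟩
    rw [← smul_add]
    exact K.smul_mem c hay
  lie_mem := by
    rintro x a ⟨ha, y, hy, hay⟩
    refine ⟨M₁.lie_mem ha, ⁅x, y⁆, M₂.lie_mem hy, ?_⟩
    rw [← lie_add]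
    exact K.lie_mem hay

theorem correspondent_le (K M₁ M₂ : LieSubmodule R L E) : correspondent K M₁ M₂ ≤ M₁ :=
  fun _ h => h.1

/-- A submodule `K` which contains exactly one element `x + y`, `y ∈ M₂`, for every `x ∈ M₁` is the
graph of a homomorphism. -/
theorem exists_hom_of_graph {K M₁ M₂ : LieSubmodule R L E} (h : M₁ ≤ correspondent K M₁ M₂)
    (hK : K ⊓ M₂ = ⊥) : ∃ φ : M₁ →ₗ⁅R,L⁆ M₂, ∀ x : M₁, (x : E) + φ x ∈ K := by
  have hex : ∀ x : M₁, ∃ y : M₂, (x : E) + y ∈ K := fun x => by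
    obtain ⟨-, y, hy, hxy⟩ := h x.2
    exact ⟨⟨y, hy⟩, hxy⟩
  choose φ hφ using hex
  have huniq : ∀ (x : M₁) (y : M₂), (x : E) + y ∈ K → φ x = y := by
    intro x y hy
    have h1 : (φ x : E) - y ∈ K ⊓ M₂ := by
      refine ⟨?_, sub_mem (φ x).2 y.2⟩
      have := sub_mem (hφ x) hy
      rwa [add_sub_add_left_eq_sub] at this
    rw [hK, LieSubmodule.mem_bot, sub_eq_zero] at h1
    exact Subtype.ext h1
  refine ⟨{ toFun := φ, map_add' := fun a b => huniq _ _ ?_, map_smul' := fun c a => huniq _ _ ?_,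
            map_lie' := fun {x a} => huniq _ _ ?_ }, hφ⟩
  · have := add_mem (hφ a) (hφ b)
    rwa [add_add_add_comm] at this
  · have := K.smul_mem c (hφ a)
    rwa [smul_add] at this
  · have := K.lie_mem (x := x) (hφ a)
    rwa [lie_add] at this

/-- The homomorphisms read off from `K` in the two directions are mutually inverse: `ψ (φ x) - x` is
the difference of two elements of `K` with the same second component, so it lies in `K ⊓ M₁`. -/
theorem exists_equiv_of_graph {K M₁ M₂ : LieSubmodule R L E} (h₁ : M₁ ≤ correspondent K M₁ M₂)
    (h₂ : M₂ ≤ correspondent K M₂ M₁) (hK₁ : K ⊓ M₁ = ⊥) (hK₂ : K ⊓ M₂ = ⊥) :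
    Nonempty (M₁ ≃ₗ⁅R,L⁆ M₂) := by
  obtain ⟨φ, hφ⟩ := exists_hom_of_graph h₁ hK₂
  obtain ⟨ψ, hψ⟩ := exists_hom_of_graph h₂ hK₁
  refine ⟨{ φ with invFun := ψ, left_inv := fun x => ?_, right_inv := fun y => ?_ }⟩
  · have h1 : (ψ (φ x) : E) - x ∈ K ⊓ M₁ := by
      refine ⟨?_, sub_mem (ψ _).2 x.2⟩
      have := sub_mem (hψ (φ x)) (hφ x)
      rwa [add_comm (x : E), add_sub_add_left_eq_sub] at this
    rw [hK₁, LieSubmodule.mem_bot, sub_eq_zero] at h1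
    exact Subtype.ext h1
  · have h1 : (φ (ψ y) : E) - y ∈ K ⊓ M₂ := by
      refine ⟨?_, sub_mem (φ _).2 y.2⟩
      have := sub_mem (hφ (ψ y)) (hψ y)
      rwa [add_comm (y : E), add_sub_add_left_eq_sub] at this
    rw [hK₂, LieSubmodule.mem_bot, sub_eq_zero] at h1
    exact Subtype.ext h1

end LieSubmodules

/-! ### Bivectors and linear independence -/

section Wedge

variable {E : Type*} [AddCommGroup E] [Module ℂ E]

theorem wedge_smul_self (v : E) (c : ℂ) : wedge v (c • v) = 0 := by
  simp [wedge]

theorem wedge_ne_zero_iff {v w : E} : wedge v w ≠ 0 ↔ LinearIndependent ℂ ![v, w] := by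
  constructor
  · intro h
    by_cases hv : v = 0
    · subst hv
      simp [wedge] at h
    · rw [LinearIndependent.pair_iff' hv]
      rintro c rfl
      exact h (wedge_smul_self v c)
  · intro h h0
    obtain ⟨f, hf⟩ := LinearMap.exists_leftInverse_of_injective _
      (LinearMap.ker_eq_bot.2 h.fintypeLinearCombination_injective)
    have hfv : f v = Pi.single 0 1 := by
      have := LinearMap.congr_fun hf (Pi.single 0 1)
      simpa [Fintype.linearCombination_apply_single] using this
    have hfw : f w = Pi.single 1 1 := by
      have := LinearMap.congr_fun hf (Pi.single 1 1)
      simpa [Fintype.linearCombination_apply_single] using this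
    -- The determinant of the coordinates given by `f` is an alternating form with value 1 on `(v,
    -- w)`. It factors through the exterior algebra, so `v ∧ w` cannot vanish.
    let D : E [⋀^Fin 2]→ₗ[ℂ] ℂ :=
      (Matrix.detRowAlternating (R := ℂ) (n := Fin 2)).compLinearMap f
    have h1 : wedge v w = ExteriorAlgebra.ιMulti ℂ 2 ![v, w] := by
      simp [wedge, ExteriorAlgebra.ιMulti_apply]
    have h2 := ExteriorAlgebra.liftAlternating_apply_ιMulti (R := ℂ)
      (Pi.single (M := fun i => E [⋀^Fin i]→ₗ[ℂ] ℂ) 2 D) ![v, w]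
    rw [← h1, h0, map_zero, Pi.single_eq_same] at h2
    have h3 : D ![v, w] = Matrix.det (1 : Matrix (Fin 2) (Fin 2) ℂ) := by
      refine congr_arg (Matrix.det (n := Fin 2) (R := ℂ)) (funext fun i => ?_)
      fin_cases i
      · exact hfv.trans (funext fun j => by fin_cases j <;> simp)
      · exact hfw.trans (funext fun j => by fin_cases j <;> simp)
    rw [h3, Matrix.det_one] at h2
    exact zero_ne_one h2

end Wedge

/-! ### Generalized eigenspaces of a diagonalizable operator -/

section Eigenspaces

theorem maxGenEigenspace_eq_eigenspace_of_iSup {K E : Type*} [Field K] [AddCommGroup E] [Module K E]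
    {f : Module.End K E} (h : ⨆ z, f.eigenspace z = ⊤) (z : K) :
    f.maxGenEigenspace z = f.eigenspace z := by
  have hle : f.eigenspace z ≤ f.maxGenEigenspace z := Module.End.genEigenspace_le_maximal f z 1
  have h1 : f.eigenspace z ⊔ ⨆ w ≠ z, f.eigenspace w = ⊤ := by
    rw [eq_top_iff, ← h]
    refine iSup_le fun w => ?_
    by_cases hw : w = z
    · rw [hw]
      exact le_sup_left
    · exact le_sup_of_le_right (le_iSup₂_of_le w hw le_rfl)
  -- The other eigenspaces complement the eigenspace of `z` and are independent of the whole
  -- generalized eigenspace of `z`; the modular law then leaves no room between the two.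
  have h2 : Disjoint (⨆ w ≠ z, f.eigenspace w) (f.maxGenEigenspace z) :=
    ((f.independent_maxGenEigenspace z).mono_right
      (iSup₂_mono fun w _ => Module.End.genEigenspace_le_maximal f w 1)).symm
  refine le_antisymm ?_ hle
  calc f.maxGenEigenspace z = (f.eigenspace z ⊔ ⨆ w ≠ z, f.eigenspace w) ⊓ f.maxGenEigenspace z := by
        rw [h1, top_inf_eq]
    _ = f.eigenspace z ⊔ (⨆ w ≠ z, f.eigenspace w) ⊓ f.maxGenEigenspace z :=
        sup_inf_assoc_of_le _ hle
    _ = f.eigenspace z := by rw [h2.eq_bot, sup_bot_eq]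
    _ ≤ f.eigenspace z := le_rfl

end Eigenspaces

/-! ### Modules generated by a highest weight vector -/

section HighestWeight

variable {L E : Type*} [LieRing L] [LieAlgebra ℂ L] [AddCommGroup E] [Module ℂ E]
  [LieRingModule L E] [LieModule ℂ L E]

/-- The sum of the eigenspaces of `f` for the eigenvalues `z` with `Re z < r`. -/
def lowerPart (f : Module.End ℂ E) (r : ℝ) : Submodule ℂ E :=
  ⨆ z ∈ {z : ℂ | z.re < r}, f.eigenspace z

theorem mem_lowerPart {f : Module.End ℂ E} {r : ℝ} {z : ℂ} {x : E} (hz : z.re < r)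
    (hx : f x = z • x) : x ∈ lowerPart f r :=
  (le_iSup₂_of_le (f := fun z (_ : z ∈ {z : ℂ | z.re < r}) => f.eigenspace z) z hz le_rfl :
    f.eigenspace z ≤ lowerPart f r) (Module.End.mem_eigenspace_iff.2 hx)

theorem lowerPart_induction {f : Module.End ℂ E} {r : ℝ} {p : Submodule ℂ E}
    (h : ∀ (z : ℂ) (x : E), z.re < r → f x = z • x → x ∈ p) : lowerPart f r ≤ p :=
  iSup₂_le fun z hz x hx => h z x hz (Module.End.mem_eigenspace_iff.1 hx)

/-- Eigenspaces are independent. Two summands are allowed because the vector to be killed is a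
difference of eigenvectors whose eigenvalues may differ. -/
theorem eq_zero_of_mem_lowerPart {f : Module.End ℂ E} {r : ℝ} {x a b : E} {z w : ℂ}
    (hx : x ∈ lowerPart f r) (ha : f a = z • a) (hz : r ≤ z.re) (hb : f b = w • b)
    (hw : r ≤ w.re) (hxab : x = a + b) : x = 0 := by
  have hd : Disjoint (lowerPart f r) (⨆ z ∈ {z : ℂ | r ≤ z.re}, f.eigenspace z) := by
    refine f.eigenspaces_iSupIndep.disjoint_biSup_biSup ?_
    exact Set.disjoint_left.2 fun z (h1 : z.re < r) (h2 : r ≤ z.re) => not_lt.2 h2 h1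
  refine Submodule.disjoint_def.1 hd x hx ?_
  rw [hxab]
  have key : ∀ (z : ℂ) (a : E), r ≤ z.re → f a = z • a →
      a ∈ ⨆ z ∈ {z : ℂ | r ≤ z.re}, f.eigenspace z := fun z a hz ha =>
    (le_iSup₂_of_le (f := fun z (_ : z ∈ {z : ℂ | r ≤ z.re}) => f.eigenspace z) z hz le_rfl :
      f.eigenspace z ≤ _) (Module.End.mem_eigenspace_iff.2 ha)
  exact add_mem (key z a hz ha) (key w b hw hb)

theorem lowerPart_lie_mem {h : L} {r s : ℝ} {y : L} {u : E}
    (hy : y ∈ lowerPart (LieAlgebra.ad ℂ L h) r)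
    (hu : u ∈ lowerPart (LieModule.toEnd ℂ L E h) s) :
    ⁅y, u⁆ ∈ lowerPart (LieModule.toEnd ℂ L E h) (r + s) := by
  have h1 : lowerPart (LieAlgebra.ad ℂ L h) r ≤
      (lowerPart (LieModule.toEnd ℂ L E h) (r + s)).comap
        ((LieModule.toEnd ℂ L E : L →ₗ[ℂ] Module.End ℂ E).flip u) := by
    refine lowerPart_induction fun z y hz hy => ?_
    have h2 : lowerPart (LieModule.toEnd ℂ L E h) s ≤
        (lowerPart (LieModule.toEnd ℂ L E h) (r + s)).comap (LieModule.toEnd ℂ L E y) := by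
      refine lowerPart_induction fun w u hw hu => ?_
      rw [Submodule.mem_comap]
      refine mem_lowerPart (z := z + w) (by simpa using add_lt_add hz hw) ?_
      rw [LieAlgebra.ad_apply] at hy
      rw [LieModule.toEnd_apply_apply] at hu ⊢
      rw [LieModule.toEnd_apply_apply, leibniz_lie, hy, hu, smul_lie, lie_smul, add_smul]
    exact h2 hu
  exact h1 hy

/-- The `L`-submodule generated by `v` is `U v`, with `U` generated by operators which lower the
real part of the `h`-eigenvalue, provided that every element of `L` acts on `v` like the sum of such
an operator and a scalar. -/
theorem lieSpan_le_span_sup_lowerPart {h : L} {v : E} {c : ℂ} (hv : ⁅h, v⁆ = c • v)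
    (hL : ∀ x : L, ∃ y ∈ lowerPart (LieAlgebra.ad ℂ L h) 0, ∃ z : ℂ, ⁅x, v⁆ = ⁅y, v⁆ + z • v) :
    (LieSubmodule.lieSpan ℂ L {v}).toSubmodule ≤
      Submodule.span ℂ {v} ⊔ lowerPart (LieModule.toEnd ℂ L E h) c.re := by
  set n := lowerPart (LieAlgebra.ad ℂ L h) 0
  let S : Set (Submodule ℂ E) := {p | v ∈ p ∧ ∀ y ∈ n, ∀ u ∈ p, ⁅y, u⁆ ∈ p}
  have hvQ : v ∈ sInf S := Submodule.mem_sInf.2 fun p hp => hp.1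
  have hyQ : ∀ y ∈ n, ∀ u ∈ sInf S, ⁅y, u⁆ ∈ sInf S := fun y hy u hu =>
    Submodule.mem_sInf.2 fun p hp => hp.2 y hy u (Submodule.mem_sInf.1 hu p hp)
  -- `sInf S` is the smallest subspace containing `v` and stable under lowering. Its `L`-stability
  -- follows from minimality: in `[x,[y,u]] = [[x,y],u] + [y,[x,u]]` the bracket `[x,y]` is again an
  -- arbitrary element of `L`, so `Q'` is itself a member of `S`.
  let Q' : Submodule ℂ E :=
    { carrier := {u | u ∈ sInf S ∧ ∀ x : L, ⁅x, u⁆ ∈ sInf S}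
      add_mem' := fun ha hb => ⟨add_mem ha.1 hb.1, fun x => by
        rw [lie_add]
        exact add_mem (ha.2 x) (hb.2 x)⟩
      zero_mem' := ⟨zero_mem _, fun x => by
        rw [lie_zero]
        exact zero_mem _⟩
      smul_mem' := fun t a ha => ⟨Submodule.smul_mem _ t ha.1, fun x => by
        rw [lie_smul]
        exact Submodule.smul_mem _ t (ha.2 x)⟩ }
  have hQ' : sInf S ≤ Q' := by
    refine sInf_le ⟨⟨hvQ, fun x => ?_⟩, fun y hy u hu => ⟨hyQ y hy u hu.1, fun x => ?_⟩⟩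
    · obtain ⟨y, hy, z, hx⟩ := hL x
      rw [hx]
      exact add_mem (hyQ y hy v hvQ) (Submodule.smul_mem _ z hvQ)
    · rw [leibniz_lie]
      exact add_mem (hu.2 _) (hyQ y hy _ (hu.2 x))
  let N : LieSubmodule ℂ L E := { sInf S with lie_mem := fun {x u} hu => (hQ' hu).2 x }
  have h1 : LieSubmodule.lieSpan ℂ L {v} ≤ N := LieSubmodule.lieSpan_le.2 (Set.singleton_subset_iff.2 hvQ)
  have h2 : sInf S ≤ Submodule.span ℂ {v} ⊔ lowerPart (LieModule.toEnd ℂ L E h) c.re := by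
    refine sInf_le ⟨Submodule.mem_sup_left (Submodule.mem_span_singleton_self v), ?_⟩
    intro y hy u hu
    refine Submodule.mem_sup_right ?_
    obtain ⟨a, ha, b, hb, rfl⟩ := Submodule.mem_sup.1 hu
    obtain ⟨t, rfl⟩ := Submodule.mem_span_singleton.1 ha
    rw [lie_add, lie_smul]
    refine add_mem (Submodule.smul_mem _ t ?_) (by simpa using lowerPart_lie_mem hy hb)
    have h3 : n ≤ (lowerPart (LieModule.toEnd ℂ L E h) c.re).comap
        ((LieModule.toEnd ℂ L E : L →ₗ[ℂ] Module.End ℂ E).flip v) := by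
      refine lowerPart_induction fun z y hz hy => ?_
      refine mem_lowerPart (z := z + c) (by simpa using hz) ?_
      rw [LieAlgebra.ad_apply] at hy
      change ⁅h, ⁅y, v⁆⁆ = (z + c) • ⁅y, v⁆
      rw [leibniz_lie, hy, hv, smul_lie, lie_smul, add_smul]
    exact h3 hy
  exact fun u hu => h2 (h1 hu)

theorem mem_span_of_mem_lieSpan {h : L} {v u : E} {c d : ℂ} (hv : ⁅h, v⁆ = c • v)
    (hL : ∀ x : L, ∃ y ∈ lowerPart (LieAlgebra.ad ℂ L h) 0, ∃ z : ℂ, ⁅x, v⁆ = ⁅y, v⁆ + z • v)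
    (hu : u ∈ LieSubmodule.lieSpan ℂ L {v}) (hud : ⁅h, u⁆ = d • u) (hcd : c.re ≤ d.re) :
    u ∈ Submodule.span ℂ {v} := by
  obtain ⟨a, ha, b, hb, hab⟩ := Submodule.mem_sup.1 (lieSpan_le_span_sup_lowerPart hv hL hu)
  obtain ⟨t, rfl⟩ := Submodule.mem_span_singleton.1 ha
  have h0 : b = 0 := by
    refine eq_zero_of_mem_lowerPart (z := d) (w := c) (a := u) (b := -(t • v)) hb hud hcd ?_ le_rfl ?_
    · rw [LieModule.toEnd_apply_apply, lie_neg, lie_smul, hv, smul_comm, smul_neg]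
    · rw [← hab]
      abel
  rw [← hab, h0, add_zero]
  exact ha

end HighestWeight

/-! ### The operator `e^x e^{-y} e^x` as a simple reflection -/

section Reflection

variable {L E : Type*} [LieRing L] [LieAlgebra ℂ L] [AddCommGroup E]
  [Module ℂ E] [FiniteDimensional ℂ E] [LieRingModule L E] [LieModule ℂ L E]

/-- The pairing `L × E → E` is respected by `x` acting as a derivation. For `E = L` this says that
`e^{ad x}` is an automorphism. -/
theorem expEnd_toEnd_lie [FiniteDimensional ℂ L] (x z : L) (m : E) :
    (expEnd (LieModule.toEnd ℂ L E x) : Module.End ℂ E) ⁅z, m⁆ =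
      ⁅(expEnd (LieModule.toEnd ℂ L L x) : Module.End ℂ L) z,
        (expEnd (LieModule.toEnd ℂ L E x) : Module.End ℂ E) m⁆ :=
  expEnd_leibniz (LieModule.toEnd ℂ L E : L →ₗ[ℂ] Module.End ℂ E)
    (fun y n => leibniz_lie x y n) z m

variable (E) in
/-- The operator `e^x e^{-y} e^x` on an `L`-module. -/
noncomputable def sl2Refl (x y : L) : (Module.End ℂ E)ˣ :=
  expEnd (LieModule.toEnd ℂ L E x) * expEnd (-LieModule.toEnd ℂ L E y) *
    expEnd (LieModule.toEnd ℂ L E x)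

theorem sl2Refl_lie [FiniteDimensional ℂ L] (x y z : L) (m : E) :
    (sl2Refl E x y : Module.End ℂ E) ⁅z, m⁆ =
      ⁅(sl2Refl L x y : Module.End ℂ L) z, (sl2Refl E x y : Module.End ℂ E) m⁆ := by
  simp only [sl2Refl, ← map_neg, Units.val_mul, Module.End.mul_apply, expEnd_toEnd_lie]

theorem sl2Refl_apply_of_lie_eq_zero {x y : L} {m : E} (hx : ⁅x, m⁆ = 0) (hy : ⁅y, m⁆ = 0) :
    (sl2Refl E x y : Module.End ℂ E) m = m := by
  have h1 : (expEnd (LieModule.toEnd ℂ L E x) : Module.End ℂ E) m = m :=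
    expEnd_apply_of_apply_eq_zero hx
  have h2 : (expEnd (-LieModule.toEnd ℂ L E y) : Module.End ℂ E) m = m :=
    expEnd_apply_of_apply_eq_zero (by simpa using hy)
  rw [sl2Refl, Units.val_mul, Units.val_mul, Module.End.mul_apply, Module.End.mul_apply, h1, h2, h1]

/-- For `z` in the Cartan subalgebra and `a = α(z)` this is the reflection of `z`. All the series
involved terminate after at most three terms. -/
theorem sl2Refl_apply_of_isSl2Triple [FiniteDimensional ℂ L] {h x y z : L} (t : IsSl2Triple h x y) {a : ℂ}
    (hx : ⁅z, x⁆ = a • x) (hy : ⁅z, y⁆ = -a • y) :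
    (sl2Refl L x y : Module.End ℂ L) z = z - a • h := by
  have hxx : (expEnd (LieModule.toEnd ℂ L L x) : Module.End ℂ L) x = x :=
    expEnd_apply_of_apply_eq_zero (by simp)
  have hzx : ⁅x, z⁆ = -a • x := by rw [← lie_skew, hx, neg_smul]
  have hzy : ⁅y, z⁆ = a • y := by rw [← lie_skew, hy, neg_smul, neg_neg]
  have hhx : ⁅x, h⁆ = -((2 : ℂ) • x) := by rw [← lie_skew, t.lie_h_e_smul ℂ]
  have hhy : ⁅y, h⁆ = (2 : ℂ) • y := by rw [← lie_skew, t.lie_lie_smul_f ℂ, neg_neg]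
  have hyx : ⁅y, x⁆ = -h := by rw [← lie_skew, t.lie_e_f]
  have e1 : (expEnd (LieModule.toEnd ℂ L L x) : Module.End ℂ L) z = z - a • x := by
    rw [expEnd_apply_of_pow_eq_zero (k := 2) (by simp [pow_two, hzx])]
    simp [Finset.sum_range_succ, hzx, sub_eq_add_neg]
  have e2 : (expEnd (LieModule.toEnd ℂ L L x) : Module.End ℂ L) h = h - (2 : ℂ) • x := by
    rw [expEnd_apply_of_pow_eq_zero (k := 2) (by simp [pow_two, hhx])]
    simp [Finset.sum_range_succ, hhx, sub_eq_add_neg]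
  have e3 : (expEnd (-LieModule.toEnd ℂ L L y) : Module.End ℂ L) z = z - a • y := by
    rw [expEnd_apply_of_pow_eq_zero (k := 2) (by simp [pow_two, hzy])]
    simp [Finset.sum_range_succ, hzy, sub_eq_add_neg]
  have e4 : (expEnd (-LieModule.toEnd ℂ L L y) : Module.End ℂ L) x = x + h - y := by
    rw [expEnd_apply_of_pow_eq_zero (k := 3) (by simp [pow_succ, hyx, hhy])]
    simp [Finset.sum_range_succ, pow_two, hyx, hhy, sub_eq_add_neg, smul_smul]
  rw [sl2Refl, Units.val_mul, Units.val_mul, Module.End.mul_apply, Module.End.mul_apply, e1,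
    map_sub, map_smul, e3, e4]
  -- This is `e^{-y} e^x z`; the last factor `e^x` cancels the remaining multiple of `x`.
  have : z - a • y - a • (x + h - y) = z - a • h - a • x := by module
  rw [this]
  simp only [map_sub, map_smul, e1, e2, hxx]
  module

end Reflection

/-! ### Conjugation-stable submodules and their real points -/

section RealStructure

variable {V : Type*} [AddCommGroup V] [Module ℝ V]

theorem one_tmul_smul (r : ℝ) (w : V) : (1 : ℂ) ⊗ₜ[ℝ] (r • w) = (r : ℂ) • ((1 : ℂ) ⊗ₜ[ℝ] w) := by
  rw [TensorProduct.tmul_smul, TensorProduct.smul_tmul', TensorProduct.smul_tmul']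
  simp

theorem one_tmul_rePart (m : ℂ ⊗[ℝ] V) : (1 : ℂ) ⊗ₜ[ℝ] rePart m = (2⁻¹ : ℂ) • (m + conj m) := by
  induction m using TensorProduct.induction_on with
  | zero => simp
  | tmul z w =>
    have h : rePart (z ⊗ₜ[ℝ] w) = z.re • w := by simp [rePart]
    rw [h, conj_tmul, ← TensorProduct.add_tmul, Complex.add_conj, one_tmul_smul,
      TensorProduct.smul_tmul', TensorProduct.smul_tmul']
    congr 1
    simp
  | add m n hm hn =>
    rw [map_add, TensorProduct.tmul_add, hm, hn, map_add, ← smul_add]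
    congr 1
    abel

theorem one_tmul_imPart (m : ℂ ⊗[ℝ] V) :
    (1 : ℂ) ⊗ₜ[ℝ] imPart m = (2 * Complex.I)⁻¹ • (m - conj m) := by
  induction m using TensorProduct.induction_on with
  | zero => simp
  | tmul z w =>
    have h : imPart (z ⊗ₜ[ℝ] w) = z.im • w := by simp [imPart]
    rw [h, conj_tmul, ← TensorProduct.sub_tmul, Complex.sub_conj, one_tmul_smul,
      TensorProduct.smul_tmul', TensorProduct.smul_tmul']
    congr 1
    simp only [smul_eq_mul, mul_one, Complex.ofReal_mul, Complex.ofReal_ofNat]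
    field_simp
  | add m n hm hn =>
    rw [map_add, TensorProduct.tmul_add, hm, hn, map_add, ← smul_add]
    congr 1
    abel

theorem eq_one_tmul_add (m : ℂ ⊗[ℝ] V) :
    m = (1 : ℂ) ⊗ₜ[ℝ] rePart m + Complex.I • ((1 : ℂ) ⊗ₜ[ℝ] imPart m) := by
  rw [one_tmul_rePart, one_tmul_imPart, smul_smul]
  have h : Complex.I * (2 * Complex.I)⁻¹ = 2⁻¹ := by
    field_simp
  rw [h, ← smul_add]
  module

theorem rePart_smul (c : ℂ) (m : ℂ ⊗[ℝ] V) :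
    rePart (c • m) = c.re • rePart m - c.im • imPart m := by
  induction m using TensorProduct.induction_on with
  | zero => simp
  | tmul z w => simp [rePart, imPart, TensorProduct.smul_tmul', sub_smul, mul_smul]
  | add m n hm hn =>
    rw [smul_add, map_add, hm, hn, map_add, map_add]
    module

theorem imPart_smul (c : ℂ) (m : ℂ ⊗[ℝ] V) :
    imPart (c • m) = c.re • imPart m + c.im • rePart m := by
  induction m using TensorProduct.induction_on with
  | zero => simp
  | tmul z w => simp [rePart, imPart, TensorProduct.smul_tmul', add_smul, mul_smul]
  | add m n hm hn =>
    rw [smul_add, map_add, hm, hn, map_add, map_add]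
    module

theorem rePart_one_tmul (w : V) : rePart ((1 : ℂ) ⊗ₜ[ℝ] w) = w := by
  simp [rePart]

theorem one_tmul_injective {w : V} (h : (1 : ℂ) ⊗ₜ[ℝ] w = 0) : w = 0 := by
  rw [← rePart_one_tmul w, h, map_zero]

theorem conj_one_tmul (w : V) : conj ((1 : ℂ) ⊗ₜ[ℝ] w) = (1 : ℂ) ⊗ₜ[ℝ] w := by
  rw [conj_tmul, map_one]

theorem rePart_eq_zero_iff {m : ℂ ⊗[ℝ] V} : rePart m = 0 ↔ conj m = -m := by
  constructor
  · intro h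
    have h1 := one_tmul_rePart m
    rw [h, TensorProduct.tmul_zero, eq_comm, smul_eq_zero] at h1
    exact eq_neg_of_add_eq_zero_right (h1.resolve_left (by norm_num))
  · intro h
    refine one_tmul_injective ?_
    rw [one_tmul_rePart, h, add_neg_cancel, smul_zero]

theorem imPart_eq_zero_iff {m : ℂ ⊗[ℝ] V} : imPart m = 0 ↔ conj m = m := by
  constructor
  · intro h
    have h1 := one_tmul_imPart m
    rw [h, TensorProduct.tmul_zero, eq_comm, smul_eq_zero] at h1
    exact (sub_eq_zero.1 (h1.resolve_left (by simp))).symm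
  · intro h
    refine one_tmul_injective ?_
    rw [one_tmul_imPart, h, sub_self, smul_zero]

variable {𝔤 : Type*} [LieRing 𝔤] [LieAlgebra ℝ 𝔤] [LieRingModule 𝔤 V] [LieModule ℝ 𝔤 V]

/-! The bracket of `𝔤^ℂ` on `V^ℂ` is found by instance search as the bare bracket of an extension of
scalars; these are its linearity rules in a form that can be used for rewriting. -/

theorem extLie_add (x : ℂ ⊗[ℝ] 𝔤) (m n : ℂ ⊗[ℝ] V) : ⁅x, m + n⁆ = ⁅x, m⁆ + ⁅x, n⁆ := lie_add x m n

theorem extAdd_lie (x y : ℂ ⊗[ℝ] 𝔤) (m : ℂ ⊗[ℝ] V) : ⁅x + y, m⁆ = ⁅x, m⁆ + ⁅y, m⁆ := add_lie x y m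

theorem extSmul_lie (c : ℂ) (x : ℂ ⊗[ℝ] 𝔤) (m : ℂ ⊗[ℝ] V) : ⁅c • x, m⁆ = c • ⁅x, m⁆ := smul_lie c x m

theorem extLie_zero (x : ℂ ⊗[ℝ] 𝔤) : ⁅x, (0 : ℂ ⊗[ℝ] V)⁆ = 0 := lie_zero x

theorem extZero_lie (m : ℂ ⊗[ℝ] V) : ⁅(0 : ℂ ⊗[ℝ] 𝔤), m⁆ = 0 := zero_lie m

theorem conj_lie (x : ℂ ⊗[ℝ] 𝔤) (m : ℂ ⊗[ℝ] V) : conj ⁅x, m⁆ = ⁅conj x, conj m⁆ := conj_act x m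

theorem mem_conjSub {M : LieSubmodule ℂ (ℂ ⊗[ℝ] 𝔤) (ℂ ⊗[ℝ] V)} {m : ℂ ⊗[ℝ] V} :
    m ∈ conjSub M ↔ conj m ∈ M := by
  constructor
  · rintro ⟨n, hn, rfl⟩
    rw [conj_conj]
    exact hn
  · exact fun h => ⟨conj m, h, conj_conj m⟩

theorem conjSub_conjSub (M : LieSubmodule ℂ (ℂ ⊗[ℝ] 𝔤) (ℂ ⊗[ℝ] V)) : conjSub (conjSub M) = M := by
  ext m
  rw [mem_conjSub, mem_conjSub, conj_conj]

theorem conjSub_mono {M N : LieSubmodule ℂ (ℂ ⊗[ℝ] 𝔤) (ℂ ⊗[ℝ] V)} (h : M ≤ N) :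
    conjSub M ≤ conjSub N := fun _ hm => mem_conjSub.2 (h (mem_conjSub.1 hm))

theorem conjSub_le_iff {M N : LieSubmodule ℂ (ℂ ⊗[ℝ] 𝔤) (ℂ ⊗[ℝ] V)} :
    conjSub M ≤ N ↔ M ≤ conjSub N :=
  ⟨fun h => by simpa only [conjSub_conjSub] using conjSub_mono h,
    fun h => by simpa only [conjSub_conjSub] using conjSub_mono h⟩

theorem conjSub_bot : conjSub (⊥ : LieSubmodule ℂ (ℂ ⊗[ℝ] 𝔤) (ℂ ⊗[ℝ] V)) = ⊥ :=
  le_bot_iff.1 (conjSub_le_iff.2 bot_le)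

theorem conjSub_isIrreducible {M : LieSubmodule ℂ (ℂ ⊗[ℝ] 𝔤) (ℂ ⊗[ℝ] V)}
    (hM : LieModule.IsIrreducible ℂ (ℂ ⊗[ℝ] 𝔤) M) :
    LieModule.IsIrreducible ℂ (ℂ ⊗[ℝ] 𝔤) (conjSub M) := by
  rw [isIrreducible_iff] at hM ⊢
  refine ⟨fun h => hM.1 ?_, fun N hN hN0 => ?_⟩
  · rw [← conjSub_conjSub M, h, conjSub_bot]
  · rw [← conjSub_conjSub N, hM.2 (conjSub N) (conjSub_le_iff.2 hN)]
    intro h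
    rw [← conjSub_conjSub N, h, conjSub_bot] at hN0
    exact hN0 rfl

theorem mem_realPoints {N : LieSubmodule ℂ (ℂ ⊗[ℝ] 𝔤) (ℂ ⊗[ℝ] V)} {w : V} :
    w ∈ realPoints N ↔ (1 : ℂ) ⊗ₜ[ℝ] w ∈ N := Iff.rfl

theorem realPoints_mono {M N : LieSubmodule ℂ (ℂ ⊗[ℝ] 𝔤) (ℂ ⊗[ℝ] V)} (h : M ≤ N) :
    realPoints M ≤ realPoints N := fun _ hw => h hw

theorem rePart_mem_realPoints {N : LieSubmodule ℂ (ℂ ⊗[ℝ] 𝔤) (ℂ ⊗[ℝ] V)} (hN : conjSub N = N)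
    {m : ℂ ⊗[ℝ] V} (hm : m ∈ N) : rePart m ∈ realPoints N := by
  rw [mem_realPoints, one_tmul_rePart]
  exact N.smul_mem _ (add_mem hm (mem_conjSub.1 (hN.symm ▸ hm)))

theorem imPart_mem_realPoints {N : LieSubmodule ℂ (ℂ ⊗[ℝ] 𝔤) (ℂ ⊗[ℝ] V)} (hN : conjSub N = N)
    {m : ℂ ⊗[ℝ] V} (hm : m ∈ N) : imPart m ∈ realPoints N := by
  rw [mem_realPoints, one_tmul_imPart]
  exact N.smul_mem _ (sub_mem hm (mem_conjSub.1 (hN.symm ▸ hm)))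

theorem realPoints_inf_eq_bot {M N : LieSubmodule ℂ (ℂ ⊗[ℝ] 𝔤) (ℂ ⊗[ℝ] V)} (h : M ⊓ N = ⊥) :
    realPoints M ⊓ realPoints N = ⊥ := by
  refine le_bot_iff.1 fun w hw => ?_
  have h1 : (1 : ℂ) ⊗ₜ[ℝ] w ∈ M ⊓ N := ⟨hw.1, hw.2⟩
  rw [h, LieSubmodule.mem_bot] at h1
  exact (LieSubmodule.mem_bot _).2 (one_tmul_injective h1)

theorem realPoints_sup {M N : LieSubmodule ℂ (ℂ ⊗[ℝ] 𝔤) (ℂ ⊗[ℝ] V)} (hM : conjSub M = M)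
    (hN : conjSub N = N) : realPoints (M ⊔ N) = realPoints M ⊔ realPoints N := by
  refine le_antisymm (fun w hw => ?_)
    (sup_le (realPoints_mono le_sup_left) (realPoints_mono le_sup_right))
  obtain ⟨m, hm, n, hn, h⟩ := (LieSubmodule.mem_sup _ _ _).1 (mem_realPoints.1 hw)
  rw [← rePart_one_tmul w, ← h, map_add]
  exact (LieSubmodule.mem_sup _ _ _).2
    ⟨_, rePart_mem_realPoints hM hm, _, rePart_mem_realPoints hN hn, rfl⟩

/-- Taking real parts preserves `K` and `N`, so a partner of a real vector may be replaced by its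
real part. Thus the real points of a graph are a graph. -/
theorem realPoints_le_correspondent {K M N : LieSubmodule ℂ (ℂ ⊗[ℝ] 𝔤) (ℂ ⊗[ℝ] V)}
    (hK : conjSub K = K) (hN : conjSub N = N) (h : M ≤ correspondent K M N) :
    realPoints M ≤ correspondent (realPoints K) (realPoints M) (realPoints N) := by
  intro w hw
  obtain ⟨-, n, hn, hwn⟩ := h hw
  refine ⟨hw, rePart n, rePart_mem_realPoints hN hn, ?_⟩
  have := rePart_mem_realPoints hK hwn
  rwa [map_add, rePart_one_tmul] at this

/-- The complexification of a `𝔤`-submodule of `V`, as a subspace of `V^ℂ`. -/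
noncomputable def complexification (U : LieSubmodule ℝ 𝔤 V) : LieSubmodule ℂ (ℂ ⊗[ℝ] 𝔤) (ℂ ⊗[ℝ] V) :=
  U.baseChange ℂ

theorem one_tmul_mem_complexification {U : LieSubmodule ℝ 𝔤 V} {w : V} (hw : w ∈ U) :
    (1 : ℂ) ⊗ₜ[ℝ] w ∈ complexification U :=
  LieSubmodule.tmul_mem_baseChange_of_mem 1 hw

theorem parts_mem_of_mem_complexification {U : LieSubmodule ℝ 𝔤 V} {m : ℂ ⊗[ℝ] V}
    (hm : m ∈ complexification U) : rePart m ∈ U ∧ imPart m ∈ U := by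
  have hm' : m ∈ U.toSubmodule.baseChange ℂ := hm
  clear hm
  rw [Submodule.baseChange_eq_span] at hm'
  induction hm' using Submodule.span_induction with
  | mem x hx =>
    obtain ⟨w, hw, rfl⟩ := hx
    refine ⟨?_, ?_⟩
    · simpa [rePart] using hw
    · simp [imPart]
  | zero => simp
  | add x y _ _ hx hy =>
    rw [map_add, map_add]
    exact ⟨add_mem hx.1 hy.1, add_mem hx.2 hy.2⟩
  | smul c x _ hx =>
    rw [rePart_smul, imPart_smul]
    exact ⟨sub_mem (U.smul_mem _ hx.1) (U.smul_mem _ hx.2),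
      add_mem (U.smul_mem _ hx.2) (U.smul_mem _ hx.1)⟩

theorem complexification_le {U : LieSubmodule ℝ 𝔤 V}
    {N : LieSubmodule ℂ (ℂ ⊗[ℝ] 𝔤) (ℂ ⊗[ℝ] V)} (h : U ≤ realPoints N) :
    complexification U ≤ N := by
  intro m hm
  obtain ⟨h1, h2⟩ := parts_mem_of_mem_complexification hm
  rw [eq_one_tmul_add m]
  exact add_mem (h h1) (N.smul_mem _ (h h2))

theorem realPoints_complexification (U : LieSubmodule ℝ 𝔤 V) :
    realPoints (complexification U) = U := by
  refine le_antisymm (fun w hw => ?_) fun w hw => one_tmul_mem_complexification hw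
  rw [← rePart_one_tmul w]
  exact (parts_mem_of_mem_complexification hw).1

theorem conjSub_complexification (U : LieSubmodule ℝ 𝔤 V) :
    conjSub (complexification U) = complexification U := by
  have h : complexification U ≤ conjSub (complexification U) := by
    refine complexification_le fun w hw => mem_conjSub.2 ?_
    rw [conj_one_tmul]
    exact one_tmul_mem_complexification hw
  exact le_antisymm (conjSub_le_iff.2 h) h

/-- A real submodule is recovered from its complexification, which is conjugation-stable; hence only
conjugation-stable `K` have to be tested. -/
theorem realPoints_isIrreducible {N : LieSubmodule ℂ (ℂ ⊗[ℝ] 𝔤) (ℂ ⊗[ℝ] V)} (hN : conjSub N = N)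
    (h0 : N ≠ ⊥) (h : ∀ K ≤ N, conjSub K = K → K ≠ ⊥ → K = N) :
    LieModule.IsIrreducible ℝ 𝔤 (realPoints N) := by
  rw [isIrreducible_iff]
  constructor
  · intro hb
    refine h0 (le_bot_iff.1 fun m hm => (LieSubmodule.mem_bot _).2 ?_)
    have h1 := rePart_mem_realPoints hN hm
    have h2 := imPart_mem_realPoints hN hm
    rw [hb, LieSubmodule.mem_bot] at h1 h2
    rw [eq_one_tmul_add m, h1, h2]
    simp
  · intro U hU hU0
    rw [← realPoints_complexification U, h _ (complexification_le hU) (conjSub_complexification U)]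
    intro hb
    refine hU0 (le_bot_iff.1 fun w hw => (LieSubmodule.mem_bot _).2 ?_)
    have h1 := one_tmul_mem_complexification hw
    rw [hb, LieSubmodule.mem_bot] at h1
    exact one_tmul_injective h1

end RealStructure

/-! ### Orbit spans of the real group are submodules -/

section OrbitSpan

variable {𝔤 : Type*} [LieRing 𝔤] [LieAlgebra ℝ 𝔤] {V : Type*} [AddCommGroup V] [Module ℝ V]
  [FiniteDimensional ℝ V] [LieRingModule 𝔤 V] [LieModule ℝ 𝔤 V]

theorem realGroup_apply_mem (B : LieSubmodule ℝ 𝔤 V) {g : (Module.End ℝ V)ˣ}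
    (hg : g ∈ realGroup 𝔤 V) {w : V} (hw : w ∈ B) : (g : Module.End ℝ V) w ∈ B := by
  induction hg using Subgroup.closure_induction'' generalizing w with
  | mem x hx =>
    obtain ⟨X, rfl⟩ := hx
    exact expEnd_mem (N := B.toSubmodule) (fun y hy => B.lie_mem hy) hw
  | inv_mem x hx =>
    obtain ⟨X, rfl⟩ := hx
    rw [← expEnd_neg]
    exact expEnd_mem (N := B.toSubmodule) (fun y hy => neg_mem (B.lie_mem hy)) hw
  | one => exact hw
  | mul x y _ _ hx hy => exact hx (hy hw)

theorem orbitSpan_le {B : LieSubmodule ℝ 𝔤 V} {u : V} (hu : u ∈ B) :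
    orbitSpan 𝔤 u ≤ B.toSubmodule := by
  refine Submodule.span_le.2 ?_
  rintro _ ⟨g, hg, rfl⟩
  exact realGroup_apply_mem B hg hu

theorem mem_orbitSpan_self (u : V) : u ∈ orbitSpan 𝔤 u :=
  Submodule.subset_span ⟨1, one_mem _, rfl⟩

theorem apply_mem_orbitSpan {u w : V} {g : (Module.End ℝ V)ˣ} (hg : g ∈ realGroup 𝔤 V)
    (hw : w ∈ orbitSpan 𝔤 u) : (g : Module.End ℝ V) w ∈ orbitSpan 𝔤 u := by
  have : orbitSpan 𝔤 u ≤ (orbitSpan 𝔤 u).comap (g : Module.End ℝ V) := by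
    refine Submodule.span_le.2 ?_
    rintro _ ⟨k, hk, rfl⟩
    exact Submodule.subset_span ⟨g * k, mul_mem hg hk, rfl⟩
  exact this hw

/-- A functional vanishing on the span vanishes along `t ↦ e^{tX} w`, hence on the derivative `X w`
at 0. -/
theorem lie_mem_orbitSpan {u w : V} (X : 𝔤) (hw : w ∈ orbitSpan 𝔤 u) : ⁅X, w⁆ ∈ orbitSpan 𝔤 u := by
  by_contra hc
  obtain ⟨l, hl, hlu⟩ := Submodule.exists_le_ker_of_notMem hc
  refine hl (apply_eq_zero_of_expEnd (f := LieModule.toEnd ℝ 𝔤 V X) (v := w) fun t => ?_)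
  refine LinearMap.mem_ker.1 (hlu (apply_mem_orbitSpan ?_ hw))
  rw [← map_smul]
  exact Subgroup.subset_closure ⟨t • X, rfl⟩

theorem toSubmodule_eq_orbitSpan {B : LieSubmodule ℝ 𝔤 V} (hB : LieModule.IsIrreducible ℝ 𝔤 B)
    {u : V} (hu : u ∈ B) (hu0 : u ≠ 0) : B.toSubmodule = orbitSpan 𝔤 u := by
  let N : LieSubmodule ℝ 𝔤 V := { orbitSpan 𝔤 u with lie_mem := fun h => lie_mem_orbitSpan _ h }
  have h1 : N = B := by
    refine (isIrreducible_iff.1 hB).2 N (orbitSpan_le hu) fun h => hu0 ?_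
    have h2 : u ∈ N := mem_orbitSpan_self u
    rwa [h, LieSubmodule.mem_bot] at h2
  rw [← h1]

end OrbitSpan

/-! ### Root decomposition and uniqueness of high weight vectors -/

section RootDecomposition

variable {𝔤 : Type*} [LieRing 𝔤] [LieAlgebra ℝ 𝔤] {𝔠 : LieSubalgebra ℝ 𝔤}

theorem cartanIncl_tmul (z : ℂ) (h : 𝔠) : cartanIncl 𝔠 (z ⊗ₜ h) = z ⊗ₜ (h : 𝔤) := rfl

theorem cartanIncl_conj (H : ℂ ⊗[ℝ] 𝔠) : cartanIncl 𝔠 (conj H) = conj (cartanIncl 𝔠 H) := by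
  induction H using TensorProduct.induction_on with
  | zero => simp
  | tmul z w => rfl
  | add x y hx hy => simp only [map_add, hx, hy]

/-- Adjoining `a` to `𝔠` gives an abelian subalgebra, so maximality applies. -/
theorem IsCartan.mem_of_forall_lie_eq_zero (h𝔠 : IsCartan 𝔠) {a : 𝔤} (ha : ∀ h ∈ 𝔠, ⁅h, a⁆ = 0) :
    a ∈ 𝔠 := by
  have hab : ∀ x ∈ 𝔠, ∀ y ∈ 𝔠, ⁅x, y⁆ = 0 := fun x hx y hy => by
    have := h𝔠.maximal_abelian.prop.trivial ⟨x, hx⟩ ⟨y, hy⟩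
    exact congr_arg Subtype.val this
  have hz : ∀ x ∈ 𝔠.toSubmodule ⊔ Submodule.span ℝ {a},
      ∀ y ∈ 𝔠.toSubmodule ⊔ Submodule.span ℝ {a}, ⁅x, y⁆ = 0 := by
    intro x hx y hy
    obtain ⟨c, hc, u, hu, rfl⟩ := Submodule.mem_sup.1 hx
    obtain ⟨d, hd, w, hw, rfl⟩ := Submodule.mem_sup.1 hy
    obtain ⟨s, rfl⟩ := Submodule.mem_span_singleton.1 hu
    obtain ⟨t, rfl⟩ := Submodule.mem_span_singleton.1 hw
    have h1 : ⁅a, d⁆ = 0 := by rw [← lie_skew, ha d hd, neg_zero]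
    simp [hab c hc d hd, ha c hc, h1]
  let 𝔞 : LieSubalgebra ℝ 𝔤 :=
    { 𝔠.toSubmodule ⊔ Submodule.span ℝ {a} with
      lie_mem' := fun {x y} hx hy => by
        change ⁅x, y⁆ ∈ 𝔠.toSubmodule ⊔ Submodule.span ℝ {a}
        rw [hz x hx y hy]
        exact zero_mem _ }
  have h1 : IsLieAbelian 𝔞 := ⟨fun x y => Subtype.ext (hz x x.2 y y.2)⟩
  have h2 : 𝔠 ≤ 𝔞 := fun x hx => Submodule.mem_sup_left hx
  exact h𝔠.maximal_abelian.le_of_ge h1 h2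
    (Submodule.mem_sup_right (Submodule.mem_span_singleton_self a))

theorem IsCartan.exists_cartanIncl_eq (h𝔠 : IsCartan 𝔠) {x : ℂ ⊗[ℝ] 𝔤} (hx : x ∈ rootSpace 𝔠 0) :
    ∃ H, cartanIncl 𝔠 H = x := by
  have h0 : ∀ h ∈ 𝔠, ⁅(1 : ℂ) ⊗ₜ[ℝ] h, x⁆ = 0 := fun h hh => by
    have := hx ((1 : ℂ) ⊗ₜ[ℝ] ⟨h, hh⟩)
    rw [LinearMap.zero_apply, zero_smul] at this
    exact this
  have key : ∀ (h : 𝔤) (x : ℂ ⊗[ℝ] 𝔤), rePart ⁅(1 : ℂ) ⊗ₜ[ℝ] h, x⁆ = ⁅h, rePart x⁆ ∧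
      imPart ⁅(1 : ℂ) ⊗ₜ[ℝ] h, x⁆ = ⁅h, imPart x⁆ := by
    intro h x
    induction x using TensorProduct.induction_on with
    | zero => simp [extLie_zero]
    | tmul z w => simp [rePart, imPart]
    | add x y hx hy => simp only [extLie_add, lie_add, map_add, hx.1, hx.2, hy.1, hy.2, and_self]
  have hre : rePart x ∈ 𝔠 := h𝔠.mem_of_forall_lie_eq_zero fun h hh => by
    rw [← (key h x).1, h0 h hh, map_zero]
  have him : imPart x ∈ 𝔠 := h𝔠.mem_of_forall_lie_eq_zero fun h hh => by
    rw [← (key h x).2, h0 h hh, map_zero]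
  refine ⟨(1 : ℂ) ⊗ₜ[ℝ] ⟨rePart x, hre⟩ + Complex.I • ((1 : ℂ) ⊗ₜ[ℝ] ⟨imPart x, him⟩), ?_⟩
  rw [map_add, map_smul, cartanIncl_tmul, cartanIncl_tmul]
  exact (eq_one_tmul_add x).symm

/-- Simultaneous diagonalization yields the joint eigenvalue only as a function; on a nonzero `y`
its linearity is forced. -/
theorem exists_mem_rootSpace {χ : 𝔠 → ℂ} {y : ℂ ⊗[ℝ] 𝔤}
    (hy : ∀ h : 𝔠, ⁅(1 : ℂ) ⊗ₜ[ℝ] (h : 𝔤), y⁆ = χ h • y) : ∃ α, y ∈ rootSpace 𝔠 α := by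
  by_cases hy0 : y = 0
  · exact ⟨0, hy0 ▸ zero_mem _⟩
  let χ' : 𝔠 →ₗ[ℝ] ℂ :=
    { toFun := χ
      map_add' := fun a b => smul_left_injective ℂ hy0 <| by
        change χ (a + b) • y = (χ a + χ b) • y
        rw [← hy, add_smul, ← hy, ← hy, ← extAdd_lie, ← TensorProduct.tmul_add]
        rfl
      map_smul' := fun r a => smul_left_injective ℂ hy0 <| by
        change χ (r • a) • y = (r • χ a) • y
        rw [← hy, Complex.real_smul, mul_smul, ← hy, ← extSmul_lie, ← one_tmul_smul]
        rfl }
  refine ⟨χ'.liftBaseChange ℂ, fun H => ?_⟩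
  rw [LieAlgebra.ad_apply]
  induction H using TensorProduct.induction_on with
  | zero => simp
  | tmul z h =>
    have h1 : (z ⊗ₜ[ℝ] (h : 𝔤) : ℂ ⊗[ℝ] 𝔤) = z • ((1 : ℂ) ⊗ₜ[ℝ] (h : 𝔤)) := by
      rw [TensorProduct.smul_tmul', smul_eq_mul, mul_one]
    rw [cartanIncl_tmul, h1, extSmul_lie, hy, LinearMap.liftBaseChange_tmul, smul_eq_mul, mul_smul]
    rfl
  | add x y hx hy => rw [map_add, extAdd_lie, hx, hy, map_add, add_smul]

theorem commute_ad_of_lie_eq_zero {L : Type*} [LieRing L] [LieAlgebra ℂ L] {x y : L}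
    (h : ⁅x, y⁆ = 0) : Commute (LieAlgebra.ad ℂ L x) (LieAlgebra.ad ℂ L y) := by
  refine LinearMap.ext fun z => ?_
  rw [Module.End.mul_apply, Module.End.mul_apply, LieAlgebra.ad_apply, LieAlgebra.ad_apply,
    LieAlgebra.ad_apply, LieAlgebra.ad_apply, leibniz_lie, h, zero_lie, zero_add]

theorem IsCartan.iSup_rootSpace [FiniteDimensional ℝ 𝔤] (h𝔠 : IsCartan 𝔠) :
    ⨆ α, rootSpace 𝔠 α = ⊤ := by
  let f : 𝔠 → Module.End ℂ (ℂ ⊗[ℝ] 𝔤) := fun h =>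
    LieAlgebra.ad ℂ (ℂ ⊗[ℝ] 𝔤) ((1 : ℂ) ⊗ₜ[ℝ] (h : 𝔤))
  have h1 := Module.End.iSup_iInf_maxGenEigenspace_eq_top_of_iSup_maxGenEigenspace_eq_top_of_commute
    f (fun a b _ => by
      refine commute_ad_of_lie_eq_zero ?_
      have h0 := congr_arg Subtype.val (h𝔠.maximal_abelian.prop.trivial a b)
      rw [LieSubalgebra.coe_bracket] at h0
      rw [LieAlgebra.ExtendScalars.bracket_tmul, h0]
      simp) (fun h => by
      simp only [maxGenEigenspace_eq_eigenspace_of_iSup (h𝔠.diagonalizable h h.2), f]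
      exact h𝔠.diagonalizable h h.2)
  rw [eq_top_iff, ← h1]
  refine iSup_le fun χ y hy => ?_
  have h2 : ∀ h : 𝔠, ⁅(1 : ℂ) ⊗ₜ[ℝ] (h : 𝔤), y⁆ = χ h • y := fun h => by
    have h3 := (Submodule.mem_iInf _).1 hy h
    simp only [f, maxGenEigenspace_eq_eigenspace_of_iSup (h𝔠.diagonalizable h h.2)] at h3
    exact Module.End.mem_eigenspace_iff.1 h3
  obtain ⟨α, hα⟩ := exists_mem_rootSpace h2
  exact (le_iSup (rootSpace 𝔠) α) hα

/-- A real functional is the real part of a complex one, which is evaluation at some `H` by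
reflexivity. Positivity of roots becomes a condition on real parts of eigenvalues of `ad H`. -/
theorem exists_eq_re_apply [FiniteDimensional ℝ 𝔤] (f : Weight 𝔠 →ₗ[ℝ] ℝ) :
    ∃ H : ℂ ⊗[ℝ] 𝔠, ∀ ν : Weight 𝔠, f ν = (ν H).re := by
  refine ⟨(Module.evalEquiv ℂ (ℂ ⊗[ℝ] 𝔠)).symm (Module.Dual.extendRCLike (𝕜 := ℂ) f), fun ν => ?_⟩
  rw [Module.apply_evalEquiv_symm_apply]
  exact (Module.Dual.re_extendRCLike_apply (𝕜 := ℂ) f ν).symm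

variable {V : Type*} [AddCommGroup V] [Module ℝ V] [LieRingModule 𝔤 V] [LieModule ℝ 𝔤 V]
  {P : Set (Weight 𝔠)} {μ ν : Weight 𝔠} {u v w : ℂ ⊗[ℝ] V}

theorem rootSpace_le_nilradical {α : Weight 𝔠} (hα : α ∈ P) : rootSpace 𝔠 α ≤ nilradical P :=
  le_iSup₂_of_le (f := fun α (_ : α ∈ P) => rootSpace 𝔠 α) α hα le_rfl

theorem IsHighWeightVector.lie_eq_zero (hv : IsHighWeightVector P μ v) {α : Weight 𝔠} (hα : α ∈ P)
    {x : ℂ ⊗[ℝ] 𝔤} (hx : x ∈ rootSpace 𝔠 α) : ⁅x, v⁆ = 0 :=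
  hv.nil x (rootSpace_le_nilradical hα hx)

theorem IsHighWeightVector.mk_of_forall_rootSpace (h0 : v ≠ 0)
    (hnil : ∀ α ∈ P, ∀ x ∈ rootSpace 𝔠 α, ⁅x, v⁆ = 0)
    (hw : ∀ H, ⁅cartanIncl 𝔠 H, v⁆ = μ H • v) : IsHighWeightVector P μ v := by
  refine ⟨h0, fun n hn => ?_, hw⟩
  have h1 : nilradical P ≤
      LinearMap.ker ((LieModule.toEnd ℂ (ℂ ⊗[ℝ] 𝔤) (ℂ ⊗[ℝ] V) :
        (ℂ ⊗[ℝ] 𝔤) →ₗ[ℂ] Module.End ℂ (ℂ ⊗[ℝ] V)).flip v) :=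
    iSup₂_le fun α hα x hx => LinearMap.mem_ker.2 (hnil α hα x hx)
  exact LinearMap.mem_ker.1 (h1 hn)

theorem IsHighWeightVector.weight_lie (hv : IsHighWeightVector P μ v) (H : ℂ ⊗[ℝ] 𝔠) :
    ⁅cartanIncl 𝔠 H, v⁆ = μ H • v := hv.weight H

/-- The action of `𝔤^ℂ` on a high weight vector, in terms of the triangular decomposition. -/
theorem IsHighWeightVector.exists_lie_eq [FiniteDimensional ℝ 𝔤] (h𝔠 : IsCartan 𝔠)
    {f : Weight 𝔠 →ₗ[ℝ] ℝ} (hf : ∀ α ∈ roots 𝔠, f α ≠ 0) (hP : P = {α ∈ roots 𝔠 | 0 < f α})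
    {H₀ : ℂ ⊗[ℝ] 𝔠} (hH₀ : ∀ ν : Weight 𝔠, f ν = (ν H₀).re) (hv : IsHighWeightVector P μ v)
    (x : ℂ ⊗[ℝ] 𝔤) :
    ∃ y ∈ lowerPart (LieAlgebra.ad ℂ (ℂ ⊗[ℝ] 𝔤) (cartanIncl 𝔠 H₀)) 0, ∃ z : ℂ,
      ⁅x, v⁆ = ⁅y, v⁆ + z • v := by
  set n := lowerPart (LieAlgebra.ad ℂ (ℂ ⊗[ℝ] 𝔤) (cartanIncl 𝔠 H₀)) 0
  let S : Submodule ℂ (ℂ ⊗[ℝ] 𝔤) :=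
    { carrier := {x | ∃ y ∈ n, ∃ z : ℂ, ⁅x, v⁆ = ⁅y, v⁆ + z • v}
      add_mem' := by
        rintro a b ⟨y, hy, z, h⟩ ⟨y', hy', z', h'⟩
        refine ⟨y + y', add_mem hy hy', z + z', ?_⟩
        rw [extAdd_lie, h, h', extAdd_lie, add_smul]
        abel
      zero_mem' := ⟨0, zero_mem _, 0, by rw [zero_smul, add_zero]⟩
      smul_mem' := by
        rintro t a ⟨y, hy, z, h⟩
        refine ⟨t • y, Submodule.smul_mem _ t hy, t * z, ?_⟩
        rw [extSmul_lie, h, smul_add, extSmul_lie, mul_smul] }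
  -- The zero root space is `𝔠^ℂ` and acts on `v` by scalars, negative root spaces lie in `n`, and
  -- positive ones kill `v`.
  have h1 : ⨆ α, rootSpace 𝔠 α ≤ S := by
    refine iSup_le fun α x hx => ?_
    by_cases hα : α = 0
    · subst hα
      obtain ⟨H, rfl⟩ := h𝔠.exists_cartanIncl_eq hx
      exact ⟨0, zero_mem _, μ H, by rw [hv.weight_lie, extZero_lie, zero_add]⟩
    by_cases hr : rootSpace 𝔠 α = ⊥
    · rw [hr, Submodule.mem_bot] at hx
      rw [hx]
      exact zero_mem _
    rcases lt_or_gt_of_ne (hf α ⟨hα, hr⟩) with h | h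
    · refine ⟨x, mem_lowerPart (z := α H₀) ?_ (hx H₀), 0, by rw [zero_smul, add_zero]⟩
      rwa [← hH₀]
    · refine ⟨0, zero_mem _, 0, ?_⟩
      rw [hv.lie_eq_zero (α := α) (hP ▸ ⟨⟨hα, hr⟩, h⟩) hx, extZero_lie, zero_smul, add_zero]
  rw [h𝔠.iSup_rootSpace] at h1
  exact h1 Submodule.mem_top

/-- The highest weight has multiplicity one in any module generated by a high weight vector,
irreducible or not. -/
theorem IsHighWeightVector.mem_span_of_weight [FiniteDimensional ℝ 𝔤] (h𝔠 : IsCartan 𝔠)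
    (hP : IsPositiveSystem 𝔠 P) (hv : IsHighWeightVector P μ v)
    (hu : u ∈ LieSubmodule.lieSpan ℂ (ℂ ⊗[ℝ] 𝔤) {v}) (huw : ∀ H, ⁅cartanIncl 𝔠 H, u⁆ = μ H • u) :
    u ∈ Submodule.span ℂ {v} := by
  obtain ⟨f, hf, hPf⟩ := hP
  obtain ⟨H₀, hH₀⟩ := exists_eq_re_apply f
  exact mem_span_of_mem_lieSpan (hv.weight_lie H₀) (hv.exists_lie_eq h𝔠 hf hPf hH₀) hu (huw H₀)
    le_rfl

theorem lieSpan_eq_of_mem {M : LieSubmodule ℂ (ℂ ⊗[ℝ] 𝔤) (ℂ ⊗[ℝ] V)}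
    (hM : LieModule.IsIrreducible ℂ (ℂ ⊗[ℝ] 𝔤) M) (hvM : v ∈ M) (hv : v ≠ 0) :
    LieSubmodule.lieSpan ℂ (ℂ ⊗[ℝ] 𝔤) {v} = M := by
  refine (isIrreducible_iff.1 hM).2 _ (LieSubmodule.lieSpan_le.2 (by simpa using hvM)) fun h => hv ?_
  exact (LieSubmodule.lieSpan_eq_bot_iff _ _ _).1 h v rfl

/-- The high weight vectors of an irreducible module are proportional. -/
theorem IsHighWeightVector.not_linearIndependent [FiniteDimensional ℝ 𝔤] (h𝔠 : IsCartan 𝔠)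
    (hP : IsPositiveSystem 𝔠 P) {M : LieSubmodule ℂ (ℂ ⊗[ℝ] 𝔤) (ℂ ⊗[ℝ] V)}
    (hM : LieModule.IsIrreducible ℂ (ℂ ⊗[ℝ] 𝔤) M) (hvM : v ∈ M) (huM : u ∈ M)
    (hv : IsHighWeightVector P μ v) (hu : IsHighWeightVector P ν u) :
    ¬ LinearIndependent ℂ ![v, u] := by
  obtain ⟨f, hf, hPf⟩ := hP
  obtain ⟨H₀, hH₀⟩ := exists_eq_re_apply f
  rcases le_total (μ H₀).re (ν H₀).re with h | h
  · have h1 := mem_span_of_mem_lieSpan (hv.weight_lie H₀) (hv.exists_lie_eq h𝔠 hf hPf hH₀)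
      (u := u) (by rwa [lieSpan_eq_of_mem hM hvM hv.ne_zero]) (hu.weight_lie H₀) h
    obtain ⟨c, hc⟩ := Submodule.mem_span_singleton.1 h1
    exact fun hli => (LinearIndependent.pair_iff' hv.ne_zero).1 hli c hc
  · have h1 := mem_span_of_mem_lieSpan (hu.weight_lie H₀) (hu.exists_lie_eq h𝔠 hf hPf hH₀)
      (u := v) (by rwa [lieSpan_eq_of_mem hM huM hu.ne_zero]) (hv.weight_lie H₀) h
    obtain ⟨c, hc⟩ := Submodule.mem_span_singleton.1 h1
    exact fun hli => (LinearIndependent.pair_iff' hu.ne_zero).1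
      (LinearIndependent.pair_symm_iff.1 hli) c hc

theorem IsHighWeightVector.exists_eq_smul [FiniteDimensional ℝ 𝔤] (h𝔠 : IsCartan 𝔠)
    (hP : IsPositiveSystem 𝔠 P) {M : LieSubmodule ℂ (ℂ ⊗[ℝ] 𝔤) (ℂ ⊗[ℝ] V)}
    (hM : LieModule.IsIrreducible ℂ (ℂ ⊗[ℝ] 𝔤) M) (hvM : v ∈ M) (huM : u ∈ M)
    (hv : IsHighWeightVector P μ v) (hu : IsHighWeightVector P ν u) : ∃ c : ℂ, u = c • v := by
  by_contra! h
  exact hv.not_linearIndependent h𝔠 hP hM hvM huM hu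
    ((LinearIndependent.pair_iff' hv.ne_zero).2 fun c hc => h c hc.symm)

/-! The submodule generated by the sum of two independent high weight vectors of the same weight -/

theorem IsHighWeightVector.add (hv : IsHighWeightVector P μ v) (hw : IsHighWeightVector P μ w)
    (h : LinearIndependent ℂ ![v, w]) : IsHighWeightVector P μ (v + w) := by
  refine ⟨fun h0 => ?_, fun n hn => by rw [map_add, hv.nil n hn, hw.nil n hn, add_zero],
    fun H => by rw [map_add, hv.weight, hw.weight, smul_add]⟩
  refine (LinearIndependent.pair_iff' hv.ne_zero).1 h (-1) ?_
  rw [neg_one_smul]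
  exact neg_eq_of_add_eq_zero_right h0

section Diagonal

variable [FiniteDimensional ℝ 𝔤] (h𝔠 : IsCartan 𝔠) (hP : IsPositiveSystem 𝔠 P)
  {M₁ M₂ : LieSubmodule ℂ (ℂ ⊗[ℝ] 𝔤) (ℂ ⊗[ℝ] V)}
  (hM₁ : LieModule.IsIrreducible ℂ (ℂ ⊗[ℝ] 𝔤) M₁) (hM₂ : LieModule.IsIrreducible ℂ (ℂ ⊗[ℝ] 𝔤) M₂)
  (hvM : v ∈ M₁) (hwM : w ∈ M₂)
  (hv : IsHighWeightVector P μ v) (hw : IsHighWeightVector P μ w)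
  (hvw : LinearIndependent ℂ ![v, w])

include h𝔠 hP hM₁ hvM hv hw hvw in
-- A nonzero intersection would be all of `M₁` and contain `v`. But the vectors of weight `μ` in the
-- module generated by `v + w` are multiples of `v + w`.
theorem lieSpan_add_inf_left : LieSubmodule.lieSpan ℂ (ℂ ⊗[ℝ] 𝔤) {v + w} ⊓ M₁ = ⊥ := by
  by_contra h
  have h1 := (isIrreducible_iff.1 hM₁).2 _ inf_le_right h
  have h2 : v ∈ LieSubmodule.lieSpan ℂ (ℂ ⊗[ℝ] 𝔤) {v + w} := (inf_eq_right.1 h1) hvM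
  have h3 := (hv.add hw hvw).mem_span_of_weight h𝔠 hP h2 hv.weight_lie
  obtain ⟨c, hc⟩ := Submodule.mem_span_singleton.1 h3
  rw [LinearIndependent.pair_iff] at hvw
  obtain ⟨h4, h5⟩ := hvw (c - 1) c (by
    rw [sub_smul, one_smul, sub_add_eq_add_sub, ← smul_add, hc, sub_self])
  rw [h5] at h4
  norm_num at h4

include h𝔠 hP hM₂ hwM hv hw hvw in
theorem lieSpan_add_inf_right : LieSubmodule.lieSpan ℂ (ℂ ⊗[ℝ] 𝔤) {v + w} ⊓ M₂ = ⊥ := by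
  rw [add_comm]
  exact lieSpan_add_inf_left h𝔠 hP hM₂ hwM hw hv (LinearIndependent.pair_symm_iff.1 hvw)

omit [FiniteDimensional ℝ 𝔤] in
include hM₁ hvM hwM in
theorem le_correspondent_of_add_mem (hv0 : v ≠ 0) {K : LieSubmodule ℂ (ℂ ⊗[ℝ] 𝔤) (ℂ ⊗[ℝ] V)}
    (h : v + w ∈ K) : M₁ ≤ correspondent K M₁ M₂ := by
  rw [(isIrreducible_iff.1 hM₁).2 _ (correspondent_le K M₁ M₂)]
  intro h0
  have h1 : v ∈ correspondent K M₁ M₂ := ⟨hvM, w, hwM, h⟩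
  rw [h0, LieSubmodule.mem_bot] at h1
  exact hv0 h1

omit [FiniteDimensional ℝ 𝔤] in
include hvM hwM in
theorem lieSpan_add_le : LieSubmodule.lieSpan ℂ (ℂ ⊗[ℝ] 𝔤) {v + w} ≤ M₁ ⊔ M₂ := by
  refine LieSubmodule.lieSpan_le.2 (Set.singleton_subset_iff.2 ?_)
  exact add_mem (LieSubmodule.mem_sup_left hvM) (LieSubmodule.mem_sup_right hwM)

omit [FiniteDimensional ℝ 𝔤] in
include hM₁ in
/-- A nonzero submodule of `M₁ + M₂` which meets `M₂` trivially projects onto `M₁`. -/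
theorem le_correspondent_of_inf_eq_bot {K : LieSubmodule ℂ (ℂ ⊗[ℝ] 𝔤) (ℂ ⊗[ℝ] V)}
    (hK : K ≤ M₁ ⊔ M₂) (hK0 : K ≠ ⊥) (hK₂ : K ⊓ M₂ = ⊥) : M₁ ≤ correspondent K M₁ M₂ := by
  rw [(isIrreducible_iff.1 hM₁).2 _ (correspondent_le K M₁ M₂)]
  intro h0
  refine hK0 (le_bot_iff.1 fun k hk => ?_)
  obtain ⟨a, ha, b, hb, rfl⟩ := (LieSubmodule.mem_sup _ _ _).1 (hK hk)
  have h1 : a ∈ correspondent K M₁ M₂ := ⟨ha, b, hb, hk⟩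
  rw [h0, LieSubmodule.mem_bot] at h1
  rw [h1, zero_add] at hk ⊢
  exact hK₂ ▸ (⟨hk, hb⟩ : b ∈ K ⊓ M₂)

include h𝔠 hP hM₁ hM₂ hvM hwM hv hw hvw in
-- A nonzero `K` inside the graph still projects onto `M₁`, so it contains some `v + b` with `b ∈
-- M₂`; as the graph meets `M₂` trivially, `b = w`, and `K` contains the generator.
theorem lieSpan_add_isIrreducible : LieModule.IsIrreducible ℂ (ℂ ⊗[ℝ] 𝔤)
    (LieSubmodule.lieSpan ℂ (ℂ ⊗[ℝ] 𝔤) {v + w}) := by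
  have hN₂ := lieSpan_add_inf_right h𝔠 hP hM₂ hwM hv hw hvw
  rw [isIrreducible_iff]
  refine ⟨fun h => (hv.add hw hvw).ne_zero ((LieSubmodule.lieSpan_eq_bot_iff _ _ _).1 h _ rfl), ?_⟩
  intro K hK hK0
  refine le_antisymm hK (LieSubmodule.lieSpan_le.2 (Set.singleton_subset_iff.2 ?_))
  obtain ⟨-, b, hb, hvb⟩ := le_correspondent_of_inf_eq_bot hM₁
    (hK.trans (lieSpan_add_le hvM hwM)) hK0
    (le_bot_iff.1 ((inf_le_inf_right M₂ hK).trans hN₂.le)) hvM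
  have h1 : b - w ∈ LieSubmodule.lieSpan ℂ (ℂ ⊗[ℝ] 𝔤) {v + w} ⊓ M₂ := by
    refine ⟨?_, sub_mem hb hwM⟩
    have := sub_mem (hK hvb) (LieSubmodule.subset_lieSpan (R := ℂ) (L := ℂ ⊗[ℝ] 𝔤)
      (Set.mem_singleton (v + w)))
    rwa [add_sub_add_left_eq_sub] at this
  rw [hN₂, LieSubmodule.mem_bot, sub_eq_zero] at h1
  exact h1 ▸ hvb

end Diagonal

end RootDecomposition

/-! ### Words in the simple reflections acting on weights and modules -/

section WeylWords

variable {𝔤 : Type*} [LieRing 𝔤] [LieAlgebra ℝ 𝔤] {𝔠 : LieSubalgebra ℝ 𝔤}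
  {P : Set (Weight 𝔠)}

/-- `m` is a vector of weight `ν` (or zero) in a module of `𝔤^ℂ`. -/
def HasWeight {E : Type*} [AddCommGroup E] [Module ℂ E] [LieRingModule (ℂ ⊗[ℝ] 𝔤) E]
    (ν : Weight 𝔠) (m : E) : Prop := ∀ H, ⁅cartanIncl 𝔠 H, m⁆ = ν H • m

theorem sl2Refl_inv {L E : Type*} [LieRing L] [LieAlgebra ℂ L] [AddCommGroup E]
    [Module ℂ E] [FiniteDimensional ℂ E] [LieRingModule L E] [LieModule ℂ L E] (x y : L) :
    (sl2Refl E x y)⁻¹ = sl2Refl E (-x) (-y) := by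
  simp only [sl2Refl, mul_inv_rev, ← expEnd_neg, map_neg, neg_neg, mul_assoc]

theorem sl2Refl_mem {L E : Type*} [LieRing L] [LieAlgebra ℂ L] [AddCommGroup E]
    [Module ℂ E] [FiniteDimensional ℂ E] [LieRingModule L E] [LieModule ℂ L E] (x y : L)
    {N : LieSubmodule ℂ L E} {m : E} (hm : m ∈ N) : (sl2Refl E x y : Module.End ℂ E) m ∈ N := by
  have h : ∀ (z : L) {m : E}, m ∈ N → (expEnd (LieModule.toEnd ℂ L E z) : Module.End ℂ E) m ∈ N :=
    fun z m hm => expEnd_mem (N := N.toSubmodule) (fun y hy => N.lie_mem hy) hm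
  simp only [sl2Refl, ← map_neg, Units.val_mul, Module.End.mul_apply]
  exact h _ (h _ (h _ hm))

theorem units_inv_apply_apply {E : Type*} [AddCommGroup E] [Module ℂ E] (g : (Module.End ℂ E)ˣ)
    (m : E) : ((g⁻¹ : (Module.End ℂ E)ˣ) : Module.End ℂ E) ((g : Module.End ℂ E) m) = m := by
  rw [← Module.End.mul_apply, ← Units.val_mul, inv_mul_cancel, Units.val_one, Module.End.one_apply]

theorem units_apply_inv_apply {E : Type*} [AddCommGroup E] [Module ℂ E] (g : (Module.End ℂ E)ˣ)
    (m : E) : (g : Module.End ℂ E) (((g⁻¹ : (Module.End ℂ E)ˣ) : Module.End ℂ E) m) = m := by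
  rw [← Module.End.mul_apply, ← Units.val_mul, mul_inv_cancel, Units.val_one, Module.End.one_apply]

namespace StandardTriples

variable (T : StandardTriples P) {α : Weight 𝔠}

theorem apply_H_self (hα : IsSimpleRoot P α) : α (T.H α) = 2 := by
  have h1 : ⁅cartanIncl 𝔠 (T.H α), T.X α⁆ = α (T.H α) • T.X α := T.X_mem α hα (T.H α)
  have h2 := (T.triple α hα).lie_h_e_smul ℂ
  exact smul_left_injective ℂ (T.triple α hα).e_ne_zero (h1.symm.trans h2)

theorem refl_refl (hα : IsSimpleRoot P α) (ν : Weight 𝔠) : T.refl α (T.refl α ν) = ν := by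
  simp only [refl, LinearMap.sub_apply, LinearMap.smul_apply, T.apply_H_self hα, smul_eq_mul]
  module

theorem sl2Refl_cartanIncl [FiniteDimensional ℝ 𝔤] (hα : IsSimpleRoot P α) (H : ℂ ⊗[ℝ] 𝔠) :
    (sl2Refl (ℂ ⊗[ℝ] 𝔤) (T.X α) (T.Y α) : Module.End ℂ (ℂ ⊗[ℝ] 𝔤)) (cartanIncl 𝔠 H) =
      cartanIncl 𝔠 (H - α H • T.H α) := by
  rw [map_sub, map_smul]
  exact sl2Refl_apply_of_isSl2Triple (T.triple α hα) (T.X_mem α hα H) (T.Y_mem α hα H)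

section

variable {E : Type*} [AddCommGroup E] [Module ℂ E] [FiniteDimensional ℂ E]
  [LieRingModule (ℂ ⊗[ℝ] 𝔤) E] [LieModule ℂ (ℂ ⊗[ℝ] 𝔤) E] {ν : Weight 𝔠} {m : E}

/-- The operator carries the action of `H` to that of `H - α(H) H_α`, and `ν(H - α(H) H_α) = (w_α
ν)(H)`. The general module `E` covers both `V^ℂ` and the adjoint module. -/
theorem hasWeight_sl2Refl_inv [FiniteDimensional ℝ 𝔤] (hα : IsSimpleRoot P α) (hm : HasWeight ν m) :
    HasWeight (T.refl α ν)
      ((((sl2Refl E (T.X α) (T.Y α))⁻¹ : (Module.End ℂ E)ˣ) : Module.End ℂ E) m) := by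
  intro H
  have h1 := sl2Refl_lie (T.X α) (T.Y α) (cartanIncl 𝔠 H)
    ((((sl2Refl E (T.X α) (T.Y α))⁻¹ : (Module.End ℂ E)ˣ) : Module.End ℂ E) m)
  rw [units_apply_inv_apply, T.sl2Refl_cartanIncl hα, hm] at h1
  rw [← units_inv_apply_apply (sl2Refl E (T.X α) (T.Y α)) ⁅cartanIncl 𝔠 H, _⁆, h1, map_smul]
  congr 1
  simp only [refl, LinearMap.sub_apply, LinearMap.smul_apply, map_sub, map_smul, smul_eq_mul]
  ring

theorem hasWeight_sl2Refl [FiniteDimensional ℝ 𝔤] (hα : IsSimpleRoot P α) (hm : HasWeight ν m) :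
    HasWeight (T.refl α ν) ((sl2Refl E (T.X α) (T.Y α) : Module.End ℂ E) m) := by
  intro H
  have h1 := sl2Refl_lie (T.X α) (T.Y α) (cartanIncl 𝔠 (H - α H • T.H α)) m
  have h2 : H - α H • T.H α - α (H - α H • T.H α) • T.H α = H := by
    rw [map_sub, map_smul, T.apply_H_self hα, smul_eq_mul]
    module
  rw [T.sl2Refl_cartanIncl hα, h2, hm, map_smul] at h1
  rw [← h1]
  congr 1
  simp only [refl, LinearMap.sub_apply, LinearMap.smul_apply, map_sub, map_smul, smul_eq_mul]
  ring

end

/-- The automorphism of `𝔤^ℂ` (as a linear map) which is induced by the word `β`. -/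
noncomputable def omegaAd [FiniteDimensional ℝ 𝔤] (β : List (Weight 𝔠)) : (Module.End ℂ (ℂ ⊗[ℝ] 𝔤))ˣ :=
  (β.map fun α => sl2Refl (ℂ ⊗[ℝ] 𝔤) (T.X α) (T.Y α)).prod

theorem omegaAd_cons [FiniteDimensional ℝ 𝔤] (α : Weight 𝔠) (β : List (Weight 𝔠))
    (x : ℂ ⊗[ℝ] 𝔤) :
    (T.omegaAd (α :: β) : Module.End ℂ (ℂ ⊗[ℝ] 𝔤)) x =
      (sl2Refl (ℂ ⊗[ℝ] 𝔤) (T.X α) (T.Y α) : Module.End ℂ (ℂ ⊗[ℝ] 𝔤))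
        ((T.omegaAd β : Module.End ℂ (ℂ ⊗[ℝ] 𝔤)) x) := by
  rw [omegaAd, omegaAd, List.map_cons, List.prod_cons, Units.val_mul, Module.End.mul_apply]

theorem omegaAd_mem_rootSpace [FiniteDimensional ℝ 𝔤] {β : List (Weight 𝔠)} (hβ : ∀ α ∈ β, IsSimpleRoot P α)
    {γ : Weight 𝔠} {x : ℂ ⊗[ℝ] 𝔤} (hx : x ∈ rootSpace 𝔠 γ) :
    (T.omegaAd β : Module.End ℂ (ℂ ⊗[ℝ] 𝔤)) x ∈ rootSpace 𝔠 (T.weyl β γ) := by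
  induction β with
  | nil => exact hx
  | cons α β ih =>
    rw [omegaAd_cons]
    have h1 := ih fun γ hγ => hβ γ (List.mem_cons_of_mem α hγ)
    exact T.hasWeight_sl2Refl (E := ℂ ⊗[ℝ] 𝔤) (hβ α List.mem_cons_self) h1

variable {V : Type*} [AddCommGroup V] [Module ℝ V] [FiniteDimensional ℝ V] [LieRingModule 𝔤 V]
  [LieModule ℝ 𝔤 V]

theorem omegaInv_nil (m : ℂ ⊗[ℝ] V) : T.omegaInv V [] m = m := by
  simp [omegaInv, omegaRep]

theorem omegaInv_cons (α : Weight 𝔠) (β : List (Weight 𝔠)) (m : ℂ ⊗[ℝ] V) :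
    T.omegaInv V (α :: β) m = T.omegaInv V β
      ((((sl2Refl (ℂ ⊗[ℝ] V) (T.X α) (T.Y α))⁻¹ : (Module.End ℂ (ℂ ⊗[ℝ] V))ˣ) :
        Module.End ℂ (ℂ ⊗[ℝ] V)) m) := by
  rw [omegaInv, omegaInv, omegaRep, List.map_cons, List.prod_cons, mul_inv_rev, Units.val_mul,
    Module.End.mul_apply]
  rfl

theorem omegaInv_mem {N : LieSubmodule ℂ (ℂ ⊗[ℝ] 𝔤) (ℂ ⊗[ℝ] V)} (β : List (Weight 𝔠))
    {m : ℂ ⊗[ℝ] V} (hm : m ∈ N) : T.omegaInv V β m ∈ N := by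
  induction β generalizing m with
  | nil => rwa [omegaInv_nil]
  | cons α β ih =>
    rw [omegaInv_cons, sl2Refl_inv]
    exact ih (sl2Refl_mem _ _ hm)

theorem omegaInv_ne_zero (β : List (Weight 𝔠)) {m : ℂ ⊗[ℝ] V} (hm : m ≠ 0) :
    T.omegaInv V β m ≠ 0 := by
  intro h
  have h1 := units_apply_inv_apply (T.omegaRep V β) m
  change (T.omegaRep V β : Module.End ℂ (ℂ ⊗[ℝ] V)) (T.omegaInv V β m) = m at h1
  rw [h, map_zero] at h1
  exact hm h1.symm

theorem hasWeight_omegaInv [FiniteDimensional ℝ 𝔤] {β : List (Weight 𝔠)} (hβ : ∀ α ∈ β, IsSimpleRoot P α) {ν : Weight 𝔠}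
    {m : ℂ ⊗[ℝ] V} (hm : HasWeight ν m) : HasWeight (T.weyl β.reverse ν) (T.omegaInv V β m) := by
  induction β generalizing m ν with
  | nil =>
    rw [omegaInv_nil]
    exact hm
  | cons α β ih =>
    rw [omegaInv_cons]
    have h1 := ih (fun γ hγ => hβ γ (List.mem_cons_of_mem α hγ))
      (T.hasWeight_sl2Refl_inv (hβ α List.mem_cons_self) hm)
    rw [weyl] at h1 ⊢
    rwa [List.reverse_cons, List.foldr_append]

theorem lie_omegaInv [FiniteDimensional ℝ 𝔤] (β : List (Weight 𝔠)) (x : ℂ ⊗[ℝ] 𝔤) (m : ℂ ⊗[ℝ] V) :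
    ⁅x, T.omegaInv V β m⁆ =
      T.omegaInv V β ⁅(T.omegaAd β : Module.End ℂ (ℂ ⊗[ℝ] 𝔤)) x, m⁆ := by
  induction β generalizing m with
  | nil =>
    rw [omegaInv_nil, omegaInv_nil]
    rfl
  | cons α β ih =>
    rw [omegaInv_cons, ih, omegaInv_cons, omegaAd_cons]
    congr 1
    have h1 := sl2Refl_lie (T.X α) (T.Y α) ((T.omegaAd β : Module.End ℂ (ℂ ⊗[ℝ] 𝔤)) x)
      ((((sl2Refl (ℂ ⊗[ℝ] V) (T.X α) (T.Y α))⁻¹ : (Module.End ℂ (ℂ ⊗[ℝ] V))ˣ) :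
        Module.End ℂ (ℂ ⊗[ℝ] V)) m)
    rw [units_apply_inv_apply] at h1
    have h2 := units_inv_apply_apply (sl2Refl (ℂ ⊗[ℝ] V) (T.X α) (T.Y α))
      ⁅(T.omegaAd β : Module.End ℂ (ℂ ⊗[ℝ] 𝔤)) x,
        (((sl2Refl (ℂ ⊗[ℝ] V) (T.X α) (T.Y α))⁻¹ : (Module.End ℂ (ℂ ⊗[ℝ] V))ˣ) :
          Module.End ℂ (ℂ ⊗[ℝ] V)) m⁆
    rw [← h2]
    exact congr_arg _ h1

theorem omegaInv_apply_of_lie_eq_zero {β : List (Weight 𝔠)} {m : ℂ ⊗[ℝ] V}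
    (hX : ∀ α ∈ β, ⁅T.X α, m⁆ = 0) (hY : ∀ α ∈ β, ⁅T.Y α, m⁆ = 0) : T.omegaInv V β m = m := by
  induction β with
  | nil => exact T.omegaInv_nil m
  | cons α β ih =>
    have h1 : (sl2Refl (ℂ ⊗[ℝ] V) (T.X α) (T.Y α) : Module.End ℂ (ℂ ⊗[ℝ] V)) m = m :=
      sl2Refl_apply_of_lie_eq_zero (hX α List.mem_cons_self) (hY α List.mem_cons_self)
    have h2 := units_inv_apply_apply (sl2Refl (ℂ ⊗[ℝ] V) (T.X α) (T.Y α)) m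
    rw [h1] at h2
    rw [omegaInv_cons, h2]
    exact ih (fun γ hγ => hX γ (List.mem_cons_of_mem α hγ))
      (fun γ hγ => hY γ (List.mem_cons_of_mem α hγ))

theorem weyl_reverse_weyl {β : List (Weight 𝔠)} (hβ : ∀ α ∈ β, IsSimpleRoot P α) (ν : Weight 𝔠) :
    T.weyl β (T.weyl β.reverse ν) = ν := by
  induction β generalizing ν with
  | nil => rfl
  | cons α β ih =>
    have h1 : T.weyl (α :: β).reverse ν = T.weyl β.reverse (T.refl α ν) := by
      rw [weyl, weyl, List.reverse_cons, List.foldr_append]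
      rfl
    have h2 : ∀ κ, T.weyl (α :: β) κ = T.refl α (T.weyl β κ) := fun _ => rfl
    rw [h1, h2, ih fun γ hγ => hβ γ (List.mem_cons_of_mem α hγ),
      T.refl_refl (hβ α List.mem_cons_self)]

theorem weyl_sub_smul (β : List (Weight 𝔠)) (c : ℂ) (ν κ : Weight 𝔠) :
    T.weyl β (ν - c • κ) = T.weyl β ν - c • T.weyl β κ := by
  induction β with
  | nil => rfl
  | cons α β ih =>
    have h2 : ∀ κ, T.weyl (α :: β) κ = T.refl α (T.weyl β κ) := fun _ => rfl
    rw [h2, h2, h2, ih]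
    simp only [refl, LinearMap.sub_apply, LinearMap.smul_apply, smul_eq_mul]
    module

end StandardTriples

theorem conj_mem_rootSpace {γ : Weight 𝔠} {x : ℂ ⊗[ℝ] 𝔤} (hx : x ∈ rootSpace 𝔠 γ) :
    conj x ∈ rootSpace 𝔠 (conjWeight γ) := by
  intro H
  have h1 := congr_arg conj (hx (conj H))
  rw [LinearMap.map_smulₛₗ, LieAlgebra.ad_apply, cartanIncl_conj] at h1
  have h2 := conj_lie (conj (cartanIncl 𝔠 H)) x
  rw [conj_conj] at h2
  exact h2.symm.trans h1

variable {V : Type*} [AddCommGroup V] [Module ℝ V] [LieRingModule 𝔤 V] [LieModule ℝ 𝔤 V]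
  {μ ν : Weight 𝔠} {v m : ℂ ⊗[ℝ] V}

theorem HasWeight.conj (hm : HasWeight ν m) : HasWeight (conjWeight ν) (RealRep.conj m) := by
  intro H
  have h1 := congr_arg RealRep.conj (hm (RealRep.conj H))
  rw [LinearMap.map_smulₛₗ, cartanIncl_conj] at h1
  have h2 := conj_lie (RealRep.conj (cartanIncl 𝔠 H)) m
  rw [conj_conj] at h2
  exact h2.symm.trans h1

theorem HasWeight.unique (hm : HasWeight ν m) (hm' : HasWeight μ m) (h0 : m ≠ 0) : ν = μ :=
  LinearMap.ext fun H => smul_left_injective ℂ h0 ((hm H).symm.trans (hm' H))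

theorem conj_ne_zero (h0 : v ≠ 0) : conj v ≠ 0 := fun h => h0 <| by
  rw [← conj_conj v, h, map_zero]

variable [FiniteDimensional ℝ V] {T : StandardTriples P} {β : List (Weight 𝔠)} {α : Weight 𝔠}

theorem IsHighWeightVector.omegaInv_conj [FiniteDimensional ℝ 𝔤] (hβ : T.IsConjWord β) (hv : IsHighWeightVector P μ v) :
    IsHighWeightVector P (T.theta β μ) (T.omegaInv V β (conj v)) := by
  refine .mk_of_forall_rootSpace (T.omegaInv_ne_zero β (conj_ne_zero hv.ne_zero)) ?_
    (T.hasWeight_omegaInv hβ.simple (HasWeight.conj hv.weight_lie))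
  intro α hα x hx
  -- The word and conjugation move `x` into the root space of `p ω α`, a positive root by the
  -- terminal condition, so the result kills `v`. Conjugating back, the image of `x` under the word
  -- kills `v̄`.
  have h1 := conj_mem_rootSpace (T.omegaAd_mem_rootSpace hβ.simple hx)
  have h2 := hv.lie_eq_zero (hβ.terminal.le ⟨α, hα, rfl⟩) h1
  have h3 := congr_arg conj h2
  rw [conj_lie, conj_conj, map_zero] at h3
  rw [T.lie_omegaInv, h3, map_zero]

theorem IsHighWeightVector.exists_nat (hv : IsHighWeightVector P μ v) (hα : IsSimpleRoot P α) :
    ∃ n : ℕ, μ (T.H α) = n ∧ (n = 0 → ⁅T.Y α, v⁆ = 0) := by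
  have h1 : (T.triple α hα).HasPrimitiveVectorWith v (μ (T.H α)) :=
    ⟨hv.ne_zero, hv.weight_lie _, hv.lie_eq_zero hα.1 (T.X_mem α hα)⟩
  obtain ⟨n, hn⟩ := h1.exists_nat
  refine ⟨n, hn, fun h0 => ?_⟩
  have h2 := h1.pow_toEnd_f_eq_zero_of_eq_nat hn
  rw [h0, zero_add, pow_one] at h2
  exact h2

/-- If `ω` fixes the highest weight `μ`, then `μ` is orthogonal to all letters of the word. -/
theorem IsHighWeightVector.apply_H_eq_zero (hP : IsPositiveSystem 𝔠 P) (hβ : T.IsConjWord β)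
    (hv : IsHighWeightVector P μ v) (hμ : T.weyl β μ = μ) : ∀ α ∈ β, μ (T.H α) = 0 := by
  obtain ⟨f, hf, hPf⟩ := hP
  have hsub : ∀ κ κ' : Weight 𝔠, ∀ n : ℕ,
      f (conjWeight (κ - (n : ℂ) • κ')) = f (conjWeight κ) + n * f (-conjWeight κ') := by
    intro κ κ' n
    have h1 : conjWeight (κ - (n : ℂ) • κ') = conjWeight κ + (n : ℝ) • (-conjWeight κ') := by
      refine LinearMap.ext fun H => ?_
      change starRingEnd ℂ (κ (conj H) - (n : ℂ) * κ' (conj H)) =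
        starRingEnd ℂ (κ (conj H)) + (n : ℝ) • (-starRingEnd ℂ (κ' (conj H)))
      rw [map_sub, map_mul, Complex.conj_natCast, Complex.real_smul, Complex.ofReal_natCast]
      ring
    rw [h1, map_add, map_smul, smul_eq_mul]
  -- Appending a letter `α` to `β₁` raises `f (p w_{β₁} μ)` by `n · f (-p w_{β₁} α)`, where `n =
  -- μ(H_α) ≥ 0` and the second factor is positive by the choice of letters. If the whole word fixes
  -- `μ`, the total growth is 0, so every `n` vanishes.
  have key : ∀ β₂ β₁ : List (Weight 𝔠), β = β₁ ++ β₂ →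
      f (conjWeight (T.weyl β₁ μ)) ≤ f (conjWeight (T.weyl (β₁ ++ β₂) μ)) ∧
      (f (conjWeight (T.weyl (β₁ ++ β₂) μ)) ≤ f (conjWeight (T.weyl β₁ μ)) →
        ∀ α ∈ β₂, μ (T.H α) = 0) := by
    intro β₂
    induction β₂ with
    | nil => exact fun β₁ _ => by simp
    | cons α β₂ ih =>
      intro β₁ h
      obtain ⟨h1, h2⟩ := ih (β₁ ++ [α]) (by simpa using h)
      have hα : IsSimpleRoot P α := hβ.simple α (by simp [h])
      obtain ⟨n, hn, -⟩ := hv.exists_nat (T := T) hα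
      have hpos : 0 < f (-conjWeight (T.weyl β₁ α)) := by
        exact (hPf.le (hβ.step β₁ α β₂ h)).2
      have h4 : T.weyl (β₁ ++ [α]) μ = T.weyl β₁ μ - (n : ℂ) • T.weyl β₁ α := by
        rw [← T.weyl_sub_smul, ← hn, StandardTriples.weyl, List.foldr_append]
        rfl
      rw [h4, hsub, List.append_assoc, List.singleton_append] at h1 h2
      have h5 : 0 ≤ (n : ℝ) * f (-conjWeight (T.weyl β₁ α)) := by positivity
      refine ⟨by linarith, fun hle => ?_⟩
      have h6 : (n : ℝ) * f (-conjWeight (T.weyl β₁ α)) = 0 := by linarith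
      have h7 : n = 0 := by
        rcases mul_eq_zero.1 h6 with h7 | h7
        · exact_mod_cast h7
        · exact absurd h7 hpos.ne'
      intro γ hγ
      rcases List.mem_cons.1 hγ with rfl | hγ
      · rw [hn, h7, Nat.cast_zero]
      · exact h2 (by linarith) γ hγ
  refine (key β [] rfl).2 ?_
  rw [List.nil_append, hμ]
  exact le_rfl

/-- For each letter, `X_α` kills `v` because `α` is positive, and `X_{-α}` kills it because `μ(H_α)
= 0`; so every factor of `ω_ρ` fixes `v`. -/
theorem IsHighWeightVector.omegaInv_apply_of_weyl_eq (hP : IsPositiveSystem 𝔠 P)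
    (hβ : T.IsConjWord β) (hv : IsHighWeightVector P μ v) (hμ : T.weyl β μ = μ) :
    T.omegaInv V β v = v := by
  refine T.omegaInv_apply_of_lie_eq_zero
    (fun α hα => hv.lie_eq_zero (hβ.simple α hα).1 (T.X_mem α (hβ.simple α hα))) fun α hα => ?_
  obtain ⟨n, hn, h⟩ := hv.exists_nat (T := T) (hβ.simple α hα)
  rw [hv.apply_H_eq_zero hP hβ hμ α hα] at hn
  exact h (by exact_mod_cast hn.symm)

end WeylWords

/-! ### The module `M + M̄` and its real form -/

section ConjugateModule

section Pairs

variable {E : Type*} [AddCommGroup E] [Module ℂ E] {v w : E} {c : ℂ}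

theorem linearIndependent_pair_smul_right (h : LinearIndependent ℂ ![v, w]) (hc : c ≠ 0) :
    LinearIndependent ℂ ![v, c • w] := by
  rw [LinearIndependent.pair_iff] at h ⊢
  intro s t hst
  rw [smul_smul] at hst
  obtain ⟨h1, h2⟩ := h s (t * c) hst
  exact ⟨h1, (mul_eq_zero.1 h2).resolve_right hc⟩

theorem linearIndependent_pair_add_sub (h : LinearIndependent ℂ ![v, w]) :
    LinearIndependent ℂ ![v + w, v + -w] := by
  rw [LinearIndependent.pair_iff] at h ⊢
  intro s t hst
  obtain ⟨h1, h2⟩ := h (s + t) (s - t) (by rw [← hst]; module)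
  have h3 : s = t := sub_eq_zero.1 h2
  rw [h3, ← two_mul] at h1
  have h4 : t = 0 := (mul_eq_zero.1 h1).resolve_left two_ne_zero
  exact ⟨h3.trans h4, h4⟩

end Pairs

variable {𝔤 : Type*} [LieRing 𝔤] [LieAlgebra ℝ 𝔤] {𝔠 : LieSubalgebra ℝ 𝔤} {P : Set (Weight 𝔠)}
  {V : Type*} [AddCommGroup V] [Module ℝ V] [LieRingModule 𝔤 V] [LieModule ℝ 𝔤 V]
  {μ : Weight 𝔠} {v u : ℂ ⊗[ℝ] V} {M : LieSubmodule ℂ (ℂ ⊗[ℝ] 𝔤) (ℂ ⊗[ℝ] V)}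

theorem IsHighWeightVector.smul (hv : IsHighWeightVector P μ v) {c : ℂ} (hc : c ≠ 0) :
    IsHighWeightVector P μ (c • v) :=
  ⟨smul_ne_zero hc hv.ne_zero, fun n hn => by rw [map_smul, hv.nil n hn, smul_zero],
    fun H => by rw [map_smul, hv.weight, smul_comm]⟩

theorem self_mem_lieSpan (x : ℂ ⊗[ℝ] V) : x ∈ LieSubmodule.lieSpan ℂ (ℂ ⊗[ℝ] 𝔤) {x} :=
  LieSubmodule.subset_lieSpan (Set.mem_singleton x)

theorem lieSpan_singleton_le {x : ℂ ⊗[ℝ] V} (hx : x ∈ M) :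
    LieSubmodule.lieSpan ℂ (ℂ ⊗[ℝ] 𝔤) {x} ≤ M :=
  LieSubmodule.lieSpan_le.2 (Set.singleton_subset_iff.2 hx)

theorem conj_mem_conjSub {m : ℂ ⊗[ℝ] V} (hm : m ∈ M) : conj m ∈ conjSub M :=
  mem_conjSub.2 ((conj_conj m).symm ▸ hm)

theorem conjSub_sup_conjSub (M : LieSubmodule ℂ (ℂ ⊗[ℝ] 𝔤) (ℂ ⊗[ℝ] V)) :
    conjSub (M ⊔ conjSub M) = M ⊔ conjSub M := by
  have h : M ⊔ conjSub M ≤ conjSub (M ⊔ conjSub M) :=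
    sup_le (conjSub_le_iff.1 le_sup_right) (conjSub_mono le_sup_left)
  exact le_antisymm (conjSub_le_iff.2 h) h

variable [FiniteDimensional ℝ V] {T : StandardTriples P} {β : List (Weight 𝔠)}

namespace StandardTriples

variable (T)

theorem omegaInv_conj_smul (β : List (Weight 𝔠)) (c : ℂ) (m : ℂ ⊗[ℝ] V) :
    T.omegaInv V β (conj (c • m)) = starRingEnd ℂ c • T.omegaInv V β (conj m) := by
  rw [LinearMap.map_smulₛₗ, map_smul]

theorem omegaInv_conj_mem_conjSub (β : List (Weight 𝔠)) {m : ℂ ⊗[ℝ] V} (hm : m ∈ M) :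
    T.omegaInv V β (conj m) ∈ conjSub M :=
  T.omegaInv_mem β (conj_mem_conjSub hm)

/-- The map `S` sends the module into its conjugate, so an `S`-eigenvector with nonzero eigenvalue
lies in the conjugate of the module it generates. -/
theorem conjSub_lieSpan_eq (β : List (Weight 𝔠)) {x : ℂ ⊗[ℝ] V} {c : ℂ} (hc : c ≠ 0)
    (hx : T.omegaInv V β (conj x) = c • x) :
    conjSub (LieSubmodule.lieSpan ℂ (ℂ ⊗[ℝ] 𝔤) {x}) = LieSubmodule.lieSpan ℂ (ℂ ⊗[ℝ] 𝔤) {x} := by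
  have h : LieSubmodule.lieSpan ℂ (ℂ ⊗[ℝ] 𝔤) {x} ≤
      conjSub (LieSubmodule.lieSpan ℂ (ℂ ⊗[ℝ] 𝔤) {x}) := by
    refine lieSpan_singleton_le ?_
    have h1 := T.omegaInv_conj_mem_conjSub β (self_mem_lieSpan (𝔤 := 𝔤) x)
    rw [hx] at h1
    have h2 := SMulMemClass.smul_mem c⁻¹ h1
    rwa [smul_smul, inv_mul_cancel₀ hc, one_smul] at h2
  exact le_antisymm (conjSub_le_iff.2 h) h

end StandardTriples

variable [FiniteDimensional ℝ 𝔤] (h𝔠 : IsCartan 𝔠) (hP : IsPositiveSystem 𝔠 P)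
  (hβ : T.IsConjWord β) (hM : LieModule.IsIrreducible ℂ (ℂ ⊗[ℝ] 𝔤) M) (hvM : v ∈ M)
  (hv : IsHighWeightVector P μ v)

include h𝔠 hP hβ hM hvM hv in
theorem inf_conjSub_eq_bot_iff :
    M ⊓ conjSub M = ⊥ ↔ LinearIndependent ℂ ![v, T.omegaInv V β (conj v)] := by
  have huM := T.omegaInv_conj_mem_conjSub β hvM
  have hu := hv.omegaInv_conj hβ
  constructor
  · intro h
    rw [LinearIndependent.pair_iff' hv.ne_zero]
    intro a ha
    have h1 : T.omegaInv V β (conj v) ∈ M ⊓ conjSub M := ⟨ha ▸ M.smul_mem a hvM, huM⟩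
    rw [h, LieSubmodule.mem_bot] at h1
    exact hu.ne_zero h1
  · intro h
    by_contra h0
    have h1 := (isIrreducible_iff.1 hM).2 _ inf_le_left h0
    have h2 := (isIrreducible_iff.1 (conjSub_isIrreducible hM)).2 _ inf_le_right h0
    have h3 : T.omegaInv V β (conj v) ∈ M := h1.le (h2.ge huM)
    exact hv.not_linearIndependent h𝔠 hP hM hvM h3 hu h

variable (hli : LinearIndependent ℂ ![v, T.omegaInv V β (conj v)]) (hθ : T.theta β μ = μ)

include h𝔠 hP hβ hM hvM hv hli hθ in
theorem exists_real_omegaInv_conj_eq :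
    ∃ d : ℝ, d ≠ 0 ∧ T.omegaInv V β (conj (T.omegaInv V β (conj v))) = (d : ℂ) • v := by
  have hu := hv.omegaInv_conj hβ
  rw [hθ] at hu
  have huM := T.omegaInv_conj_mem_conjSub β hvM
  have hSu := hu.omegaInv_conj hβ
  have hSuM := T.omegaInv_conj_mem_conjSub β huM
  rw [conjSub_conjSub] at hSuM
  obtain ⟨c, hc⟩ := hv.exists_eq_smul h𝔠 hP hM hvM hSuM hSu
  set u := T.omegaInv V β (conj v) with hu_def
  have hc0 : c ≠ 0 := by
    rintro rfl
    rw [zero_smul] at hc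
    exact hSu.ne_zero hc
  have hN := lieSpan_add_inf_right h𝔠 hP (conjSub_isIrreducible hM) huM hv hu hli
  set N := LieSubmodule.lieSpan ℂ (ℂ ⊗[ℝ] 𝔤) {v + u}
  have hvu : v + u ∈ N := self_mem_lieSpan _
  have h1 := T.omegaInv_conj_mem_conjSub β (T.omegaInv_conj_mem_conjSub β hvu)
  rw [conjSub_conjSub, map_add, map_add, ← hu_def, hc, map_add, map_add, hc,
    T.omegaInv_conj_smul, ← hu_def] at h1
  -- Here `h1` says that `S²(v + u) = c v + c̄ u` lies in the graph `N`; the second coefficient is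
  -- conjugated because `S` is antilinear. Subtracting `c (v + u)` leaves an element of `M̄`.
  have h2 : (starRingEnd ℂ c - c) • u ∈ N ⊓ conjSub M := by
    refine ⟨?_, SMulMemClass.smul_mem _ huM⟩
    have h3 := sub_mem h1 (N.smul_mem c hvu)
    have h4 : c • v + starRingEnd ℂ c • u - c • (v + u) = (starRingEnd ℂ c - c) • u := by module
    rwa [h4] at h3
  rw [hN, LieSubmodule.mem_bot, smul_eq_zero, sub_eq_zero] at h2
  have h5 : (c.re : ℂ) = c := Complex.conj_eq_iff_re.1 (h2.resolve_right hu.ne_zero)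
  refine ⟨c.re, fun h => hc0 ?_, by rw [h5, hc]⟩
  rw [← h5, h, Complex.ofReal_zero]

include h𝔠 hP hβ hM hv hli hθ in
-- The graph generated by `v + u` yields mutually inverse maps; `ψ` is the inverse scaled by `d`.
theorem exists_hom_comp_eq (d : ℂ) :
    ∃ (φ : M →ₗ⁅ℂ, ℂ ⊗[ℝ] 𝔤⁆ conjSub M) (ψ : conjSub M →ₗ⁅ℂ, ℂ ⊗[ℝ] 𝔤⁆ M),
      (φ ⟨v, hvM⟩ : ℂ ⊗[ℝ] V) = T.omegaInv V β (conj v) ∧ ∀ m : M, ψ (φ m) = d • m := by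
  have hu := hv.omegaInv_conj hβ
  rw [hθ] at hu
  have huM := T.omegaInv_conj_mem_conjSub β hvM
  set u := T.omegaInv V β (conj v)
  have hM' := conjSub_isIrreducible hM
  have hN₁ := lieSpan_add_inf_left h𝔠 hP hM hvM hv hu hli
  have hN₂ := lieSpan_add_inf_right h𝔠 hP hM' huM hv hu hli
  have hvu : v + u ∈ LieSubmodule.lieSpan ℂ (ℂ ⊗[ℝ] 𝔤) {v + u} := self_mem_lieSpan _
  have huv : u + v ∈ LieSubmodule.lieSpan ℂ (ℂ ⊗[ℝ] 𝔤) {v + u} := add_comm u v ▸ hvu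
  obtain ⟨φ, hφ⟩ := exists_hom_of_graph (le_correspondent_of_add_mem hM hvM huM hv.ne_zero hvu) hN₂
  obtain ⟨ψ, hψ⟩ := exists_hom_of_graph (le_correspondent_of_add_mem hM' huM hvM hu.ne_zero huv) hN₁
  set N := LieSubmodule.lieSpan ℂ (ℂ ⊗[ℝ] 𝔤) {v + u}
  refine ⟨φ, d • ψ, ?_, fun m => ?_⟩
  · have h1 : (φ ⟨v, hvM⟩ : ℂ ⊗[ℝ] V) - u ∈ N ⊓ conjSub M := by
      refine ⟨?_, sub_mem (φ ⟨v, hvM⟩).2 huM⟩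
      have := sub_mem (hφ ⟨v, hvM⟩) hvu
      rwa [add_sub_add_left_eq_sub] at this
    rw [hN₂, LieSubmodule.mem_bot, sub_eq_zero] at h1
    exact h1
  · have h1 : (ψ (φ m) : ℂ ⊗[ℝ] V) - m ∈ N ⊓ M := by
      refine ⟨?_, sub_mem (ψ (φ m)).2 m.2⟩
      have := sub_mem (hψ (φ m)) (hφ m)
      rwa [add_comm (m : ℂ ⊗[ℝ] V), add_sub_add_left_eq_sub] at this
    rw [hN₁, LieSubmodule.mem_bot, sub_eq_zero] at h1
    rw [LieModuleHom.smul_apply, Subtype.ext h1]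

include hP hβ hv hθ in
/-- If `v̄` is a multiple of `ω_ρ⁻¹ v̄`, then both are equal. -/
theorem omegaInv_conj_eq_of_conj_eq_smul {c : ℂ} (h : conj v = c • T.omegaInv V β (conj v)) :
    T.omegaInv V β (conj v) = conj v := by
  have hu := hv.omegaInv_conj hβ
  rw [hθ] at hu
  have hc : c ≠ 0 := by
    rintro rfl
    rw [zero_smul] at h
    exact conj_ne_zero hv.ne_zero h
  have hcv : IsHighWeightVector P μ (conj v) := h ▸ hu.smul hc
  -- The vector `v̄` has weight `μ^σ` by conjugation and weight `μ` as a multiple of `ω_ρ⁻¹ v̄`.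
  -- Then `Θ(μ) = μ` turns into `ω μ = μ`.
  have hμ : conjWeight μ = μ :=
    (HasWeight.conj hv.weight_lie).unique hcv.weight_lie (conj_ne_zero hv.ne_zero)
  refine hcv.omegaInv_apply_of_weyl_eq hP hβ ?_
  have h1 := T.weyl_reverse_weyl hβ.simple (conjWeight μ)
  change T.weyl β (T.theta β μ) = _ at h1
  rwa [hθ, hμ] at h1

include h𝔠 hP hβ hM hvM hv hθ in
theorem realPoints_isIrreducible_of_neg {d : ℝ} (hd : d < 0)
    (hS : T.omegaInv V β (conj (T.omegaInv V β (conj v))) = (d : ℂ) • v) :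
    LieModule.IsIrreducible ℝ 𝔤 (realPoints (M ⊔ conjSub M)) := by
  have hu := hv.omegaInv_conj hβ
  rw [hθ] at hu
  have huM := T.omegaInv_conj_mem_conjSub β hvM
  set u := T.omegaInv V β (conj v) with hu_def
  have hM' := conjSub_isIrreducible hM
  refine realPoints_isIrreducible (conjSub_sup_conjSub M) (fun h => (isIrreducible_iff.1 hM).1
    (le_bot_iff.1 (le_sup_left.trans h.le))) fun K hK hKc hK0 => le_antisymm hK ?_
  by_cases hKM : K ⊓ M = ⊥
  · exfalso
    have hKM' : K ⊓ conjSub M = ⊥ := by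
      refine le_bot_iff.1 fun x hx => (LieSubmodule.mem_bot _).2 ?_
      have h1 : conj x ∈ K ⊓ M := ⟨mem_conjSub.1 (hKc.ge hx.1), mem_conjSub.1 hx.2⟩
      rw [hKM, LieSubmodule.mem_bot] at h1
      rw [← conj_conj x, h1, map_zero]
    obtain ⟨-, b, hb, hvb⟩ := le_correspondent_of_inf_eq_bot hM hK hK0 hKM' hvM
    have hb0 : b ≠ 0 := by
      rintro rfl
      rw [add_zero] at hvb
      have h1 : v ∈ K ⊓ M := ⟨hvb, hvM⟩
      rw [hKM, LieSubmodule.mem_bot] at h1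
      exact hv.ne_zero h1
    -- Whatever annihilates `v` maps `v + b ∈ K` to its effect on `b`, which lies in `K ⊓ M̄ = 0`;
    -- the weight equation is inherited in the same way.
    have hbw : IsHighWeightVector P μ b := by
      refine .mk_of_forall_rootSpace hb0 (fun α hα x hx => ?_) fun H => ?_
      · have h1 : ⁅x, b⁆ ∈ K ⊓ conjSub M := by
          refine ⟨?_, (conjSub M).lie_mem hb⟩
          have h2 : ⁅x, v + b⁆ ∈ K := K.lie_mem hvb
          rwa [extLie_add, hv.lie_eq_zero hα hx, zero_add] at h2
        rwa [hKM', LieSubmodule.mem_bot] at h1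
      · have h1 : ⁅cartanIncl 𝔠 H, b⁆ - μ H • b ∈ K ⊓ conjSub M := by
          refine ⟨?_, sub_mem ((conjSub M).lie_mem hb) (SMulMemClass.smul_mem _ hb)⟩
          have h2 : ⁅cartanIncl 𝔠 H, v + b⁆ - μ H • (v + b) ∈ K :=
            sub_mem (K.lie_mem hvb) (K.smul_mem _ hvb)
          rwa [extLie_add, hv.weight_lie, smul_add, add_sub_add_left_eq_sub] at h2
        rwa [hKM', LieSubmodule.mem_bot, sub_eq_zero] at h1
    obtain ⟨c, rfl⟩ := hu.exists_eq_smul h𝔠 hP hM' huM hb hbw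
    have h1 := T.omegaInv_conj_mem_conjSub β hvb
    rw [hKc, map_add, map_add, T.omegaInv_conj_smul, hS, ← hu_def] at h1
    -- Both `v + c u` and `S(v + c u) = u + c̄ d v` lie in `K`; eliminating `u` gives `|c|² d = 1`,
    -- impossible for `d < 0`.
    have h2 : (c * starRingEnd ℂ c * d - 1) • v ∈ K ⊓ M := by
      refine ⟨?_, M.smul_mem _ hvM⟩
      have h3 := sub_mem (K.smul_mem c h1) hvb
      have h4 : c • (u + starRingEnd ℂ c • (d : ℂ) • v) - (v + c • u) =
          (c * starRingEnd ℂ c * d - 1) • v := by module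
      rwa [h4] at h3
    rw [hKM, LieSubmodule.mem_bot, smul_eq_zero] at h2
    have h3 := sub_eq_zero.1 (h2.resolve_right hv.ne_zero)
    rw [Complex.mul_conj, ← Complex.ofReal_mul, ← Complex.ofReal_one, Complex.ofReal_inj] at h3
    have h4 := mul_nonpos_of_nonneg_of_nonpos (Complex.normSq_nonneg c) hd.le
    linarith
  · have h1 : M ≤ K := by
      rw [← (isIrreducible_iff.1 hM).2 _ inf_le_right hKM]
      exact inf_le_left
    exact sup_le h1 ((conjSub_mono h1).trans hKc.le)

include h𝔠 hP hβ hM hvM hv hli hθ in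
theorem exists_decomposition_of_pos {d : ℝ} (hd : 0 < d)
    (hS : T.omegaInv V β (conj (T.omegaInv V β (conj v))) = (d : ℂ) • v) (v₁ v₂ : ℂ ⊗[ℝ] V)
    (hv₁ : v₁ = v + (((Real.sqrt d)⁻¹ : ℝ) : ℂ) • T.omegaInv V β (conj v))
    (hv₂ : v₂ = v - (((Real.sqrt d)⁻¹ : ℝ) : ℂ) • T.omegaInv V β (conj v)) :
    ∃ B₁ B₂ : LieSubmodule ℝ 𝔤 V,
      LieModule.IsIrreducible ℝ 𝔤 B₁ ∧ LieModule.IsIrreducible ℝ 𝔤 B₂ ∧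
      Nonempty (B₁ ≃ₗ⁅ℝ,𝔤⁆ B₂) ∧ Disjoint B₁ B₂ ∧
      B₁ ⊔ B₂ = realPoints (M ⊔ conjSub M) ∧
      B₁.toSubmodule = orbitSpan 𝔤 (rePart v₁) ∧
      (imPart v₁ ≠ 0 → B₁.toSubmodule = orbitSpan 𝔤 (imPart v₁)) ∧
      B₂.toSubmodule = orbitSpan 𝔤 (imPart v₂) ∧
      (rePart v₂ ≠ 0 → B₂.toSubmodule = orbitSpan 𝔤 (rePart v₂)) := by
  have hu := hv.omegaInv_conj hβ
  rw [hθ] at hu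
  have huM := T.omegaInv_conj_mem_conjSub β hvM
  have hinf := (inf_conjSub_eq_bot_iff h𝔠 hP hβ hM hvM hv).2 hli
  have hM' := conjSub_isIrreducible hM
  have hfix := fun c => omegaInv_conj_eq_of_conj_eq_smul (c := c) hP hβ hv hθ
  set u := T.omegaInv V β (conj v) with hu_def
  set r := Real.sqrt d
  have hr : 0 < r := Real.sqrt_pos.2 hd
  have hr0 : (r : ℂ) ≠ 0 := Complex.ofReal_ne_zero.2 hr.ne'
  have hdr : (d : ℂ) = r * r := by
    rw [← Complex.ofReal_mul, Real.mul_self_sqrt hd.le]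
  rw [Complex.ofReal_inv] at hv₁ hv₂
  set s : ℂ := (r : ℂ)⁻¹ with hs
  have hs0 : s ≠ 0 := inv_ne_zero hr0
  have hrs : (r : ℂ) * s = 1 := mul_inv_cancel₀ hr0
  have hs_conj : starRingEnd ℂ s = s := by rw [hs, map_inv₀, Complex.conj_ofReal]
  rw [sub_eq_add_neg] at hv₂
  have hsu := hu.smul hs0
  have hsuM : s • u ∈ conjSub M := SMulMemClass.smul_mem s huM
  have hnsu : IsHighWeightVector P μ (-(s • u)) := by
    rw [← neg_smul]
    exact hu.smul (neg_ne_zero.2 hs0)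
  have hli₁ := linearIndependent_pair_smul_right hli hs0
  have hli₂ : LinearIndependent ℂ ![v, -(s • u)] := by
    rw [← neg_smul]
    exact linearIndependent_pair_smul_right hli (neg_ne_zero.2 hs0)
  have hli₁₂ : LinearIndependent ℂ ![v₁, v₂] := by
    rw [hv₁, hv₂]
    exact linearIndependent_pair_add_sub hli₁
  have hw₁ : IsHighWeightVector P μ v₁ := hv₁ ▸ hv.add hsu hli₁
  have hw₂ : IsHighWeightVector P μ v₂ := hv₂ ▸ hv.add hnsu hli₂
  have hS₁ : T.omegaInv V β (conj v₁) = (r : ℂ) • v₁ := by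
    rw [hv₁, map_add, map_add, T.omegaInv_conj_smul, ← hu_def, hS, hs_conj, hdr, smul_add,
      smul_smul, smul_smul, hrs, one_smul, ← mul_assoc, mul_comm s, hrs, one_mul, add_comm]
  have hS₂ : T.omegaInv V β (conj v₂) = (-r : ℂ) • v₂ := by
    rw [hv₂, map_add, map_add, map_neg, map_neg, T.omegaInv_conj_smul, ← hu_def, hS, hs_conj, hdr,
      smul_add, smul_neg, neg_smul, neg_smul, neg_neg, smul_smul, smul_smul, hrs, one_smul,
      ← mul_assoc, mul_comm s, hrs, one_mul, add_comm]
  have hN₁ : LieModule.IsIrreducible ℂ (ℂ ⊗[ℝ] 𝔤) (LieSubmodule.lieSpan ℂ (ℂ ⊗[ℝ] 𝔤) {v₁}) :=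
    hv₁ ▸ lieSpan_add_isIrreducible h𝔠 hP hM hM' hvM hsuM hv hsu hli₁
  have hN₂ : LieModule.IsIrreducible ℂ (ℂ ⊗[ℝ] 𝔤) (LieSubmodule.lieSpan ℂ (ℂ ⊗[ℝ] 𝔤) {v₂}) :=
    hv₂ ▸ lieSpan_add_isIrreducible h𝔠 hP hM hM' hvM (neg_mem hsuM) hv hnsu hli₂
  have hc₁ := T.conjSub_lieSpan_eq β hr0 hS₁
  have hc₂ := T.conjSub_lieSpan_eq β (neg_ne_zero.2 hr0) hS₂
  have hle₁ : LieSubmodule.lieSpan ℂ (ℂ ⊗[ℝ] 𝔤) {v₁} ≤ M ⊔ conjSub M :=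
    hv₁ ▸ lieSpan_add_le hvM hsuM
  have hle₂ : LieSubmodule.lieSpan ℂ (ℂ ⊗[ℝ] 𝔤) {v₂} ≤ M ⊔ conjSub M :=
    hv₂ ▸ lieSpan_add_le hvM (neg_mem hsuM)
  have hm₁ : v₁ ∈ LieSubmodule.lieSpan ℂ (ℂ ⊗[ℝ] 𝔤) {v₁} := self_mem_lieSpan v₁
  have hm₂ : v₂ ∈ LieSubmodule.lieSpan ℂ (ℂ ⊗[ℝ] 𝔤) {v₂} := self_mem_lieSpan v₂
  -- The factor `i` compensates for the opposite eigenvalues of `v₁` and `v₂`: antilinearity gives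
  -- `S(i v₂) = -i(-r) v₂ = r (i v₂)`. So the module generated by `v₁ + i v₂` is conjugation-stable,
  -- as it must be to relate the real points.
  have hKS : T.omegaInv V β (conj (v₁ + Complex.I • v₂)) = (r : ℂ) • (v₁ + Complex.I • v₂) := by
    rw [map_add, map_add, T.omegaInv_conj_smul, hS₁, hS₂, Complex.conj_I]
    module
  have hcK := T.conjSub_lieSpan_eq β hr0 hKS
  have hIw₂ := hw₂.smul Complex.I_ne_zero
  have hliK := linearIndependent_pair_smul_right hli₁₂ Complex.I_ne_zero
  have hmK := self_mem_lieSpan (𝔤 := 𝔤) (v₁ + Complex.I • v₂)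
  set N₁ := LieSubmodule.lieSpan ℂ (ℂ ⊗[ℝ] 𝔤) {v₁}
  set N₂ := LieSubmodule.lieSpan ℂ (ℂ ⊗[ℝ] 𝔤) {v₂}
  have hIm₂ : Complex.I • v₂ ∈ N₂ := N₂.smul_mem _ hm₂
  have hK₁ := lieSpan_add_inf_left h𝔠 hP hN₁ hm₁ hw₁ hIw₂ hliK
  have hK₂ := lieSpan_add_inf_right h𝔠 hP hN₂ hIm₂ hw₁ hIw₂ hliK
  have hg₁ := le_correspondent_of_add_mem hN₁ hm₁ hIm₂ hw₁.ne_zero hmK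
  have hmK' : Complex.I • v₂ + v₁ ∈
      LieSubmodule.lieSpan ℂ (ℂ ⊗[ℝ] 𝔤) {v₁ + Complex.I • v₂} := by
    rw [add_comm (Complex.I • v₂) v₁]
    exact hmK
  have hg₂ := le_correspondent_of_add_mem hN₂ hIm₂ hm₁ hIw₂.ne_zero hmK'
  have hdisj : N₁ ⊓ N₂ = ⊥ := by
    by_contra h
    have h1 := (isIrreducible_iff.1 hN₁).2 _ inf_le_left h
    have h2 := (isIrreducible_iff.1 hN₂).2 _ inf_le_right h
    exact hw₁.not_linearIndependent h𝔠 hP hN₁ hm₁ (h1.le (h2.ge hm₂)) hw₂ hli₁₂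
  have hsup : N₁ ⊔ N₂ = M ⊔ conjSub M := by
    refine le_antisymm (sup_le hle₁ hle₂) ?_
    have h1 : v₁ ∈ N₁ ⊔ N₂ := LieSubmodule.mem_sup_left hm₁
    have h2 : v₂ ∈ N₁ ⊔ N₂ := LieSubmodule.mem_sup_right hm₂
    have h3 : v ∈ N₁ ⊔ N₂ := by
      have h4 : v = (2⁻¹ : ℂ) • (v₁ + v₂) := by
        rw [hv₁, hv₂]
        module
      rw [h4]
      exact SMulMemClass.smul_mem _ (add_mem h1 h2)
    have h5 : s • u ∈ N₁ ⊔ N₂ := by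
      have h6 : s • u = v₁ - v := by
        rw [hv₁, add_sub_cancel_left]
      rw [h6]
      exact sub_mem h1 h3
    refine sup_le ?_ ?_
    · rw [← lieSpan_eq_of_mem hM hvM hv.ne_zero]
      exact lieSpan_singleton_le h3
    · rw [← lieSpan_eq_of_mem hM' hsuM hsu.ne_zero]
      exact lieSpan_singleton_le h5
  have hB₁ := realPoints_isIrreducible hc₁ (isIrreducible_iff.1 hN₁).1
    fun K hK _ hK0 => (isIrreducible_iff.1 hN₁).2 K hK hK0
  have hB₂ := realPoints_isIrreducible hc₂ (isIrreducible_iff.1 hN₂).1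
    fun K hK _ hK0 => (isIrreducible_iff.1 hN₂).2 K hK hK0
  -- If `v̄ = -s u`, then `u = v̄`, whence `(1 + s) u = 0` although `s = 1/√d > 0`.
  have hcontra : conj v + s • u ≠ 0 := by
    intro h
    have h1 : conj v = (-s) • u := by
      rw [neg_smul]
      exact eq_neg_of_add_eq_zero_left h
    have h2 := hfix _ h1
    rw [← h2, ← one_smul ℂ u, smul_smul, mul_one, ← add_smul, smul_eq_zero] at h
    have h3 := h.resolve_right hu.ne_zero
    rw [hs, ← Complex.ofReal_inv, ← Complex.ofReal_one, ← Complex.ofReal_add,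
      Complex.ofReal_eq_zero] at h3
    have : 0 < r⁻¹ := inv_pos.2 hr
    linarith
  have hcu : conj u ∈ M := mem_conjSub.1 huM
  have hcv : conj v ∈ conjSub M := conj_mem_conjSub hvM
  have hinf' : ∀ x ∈ M, x ∈ conjSub M → x = 0 := fun x hx hx' =>
    (LieSubmodule.mem_bot x).1 (hinf.le (⟨hx, hx'⟩ : x ∈ M ⊓ conjSub M))
  -- If `v₁` were purely imaginary, `v̄ + s u ∈ M̄` would equal `-(v + s ū) ∈ M`, hence vanish. The
  -- argument for `Im v₂` differs only in signs.
  have hre : rePart v₁ ≠ 0 := by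
    intro h
    rw [rePart_eq_zero_iff, hv₁, map_add, LinearMap.map_smulₛₗ, hs_conj] at h
    refine hcontra (hinf' _ ?_ (add_mem hcv hsuM))
    have h1 : conj v + s • u = -(v + s • conj u) := by
      rw [eq_sub_of_add_eq h]
      abel
    rw [h1]
    exact neg_mem (add_mem hvM (M.smul_mem s hcu))
  have him : imPart v₂ ≠ 0 := by
    intro h
    rw [imPart_eq_zero_iff, hv₂, map_add, map_neg, LinearMap.map_smulₛₗ, hs_conj] at h
    refine hcontra (hinf' _ ?_ (add_mem hcv hsuM))
    have h1 : conj v + s • u = v + s • conj u := by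
      rw [eq_sub_of_add_eq h]
      abel
    rw [h1]
    exact add_mem hvM (M.smul_mem s hcu)
  refine ⟨realPoints N₁, realPoints N₂, hB₁, hB₂, ?_, ?_, ?_, ?_, ?_, ?_, ?_⟩
  · exact exists_equiv_of_graph (realPoints_le_correspondent hcK hc₂ hg₁)
      (realPoints_le_correspondent hcK hc₁ hg₂) (realPoints_inf_eq_bot hK₁)
      (realPoints_inf_eq_bot hK₂)
  · exact disjoint_iff.2 (realPoints_inf_eq_bot hdisj)
  · rw [← realPoints_sup hc₁ hc₂, hsup]
  · exact toSubmodule_eq_orbitSpan hB₁ (rePart_mem_realPoints hc₁ hm₁) hre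
  · exact toSubmodule_eq_orbitSpan hB₁ (imPart_mem_realPoints hc₁ hm₁)
  · exact toSubmodule_eq_orbitSpan hB₂ (imPart_mem_realPoints hc₂ hm₂) him
  · exact toSubmodule_eq_orbitSpan hB₂ (rePart_mem_realPoints hc₂ hm₂)

end ConjugateModule

end RealRep

theorem lemma4p8
    {𝔤 : Type*} [LieRing 𝔤] [LieAlgebra ℝ 𝔤] [FiniteDimensional ℝ 𝔤] [LieAlgebra.IsSemisimple ℝ 𝔤]
    {V : Type*} [AddCommGroup V] [Module ℝ V] [FiniteDimensional ℝ V]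
    [LieRingModule 𝔤 V] [LieModule ℝ 𝔤 V]
    (𝔠 : LieSubalgebra ℝ 𝔤) (h𝔠 : IsCartan 𝔠)
    (P : Set (Weight 𝔠)) (hP : IsPositiveSystem 𝔠 P)
    (T : StandardTriples P) (β : List (Weight 𝔠)) (hβ : T.IsConjWord β)
    (M : LieSubmodule ℂ (ℂ ⊗[ℝ] 𝔤) (ℂ ⊗[ℝ] V))
    (hM : LieModule.IsIrreducible ℂ (ℂ ⊗[ℝ] 𝔤) M)
    (μ : Weight 𝔠) (v : ℂ ⊗[ℝ] V) (hvM : v ∈ M) (hv : IsHighWeightVector P μ v) :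
    -- `M ∩ M̄ = 0` if and only if `v ∧ ω_ρ⁻¹ v̄ ≠ 0`
    (M ⊓ conjSub M = ⊥ ↔ wedge v (T.omegaInv V β (conj v)) ≠ 0) ∧
    -- `M̄` is irreducible with highest weight vector `ω_ρ⁻¹ v̄`, of weight `Θ(μ)`
    (LieModule.IsIrreducible ℂ (ℂ ⊗[ℝ] 𝔤) (conjSub M) ∧
      T.omegaInv V β (conj v) ∈ conjSub M ∧
      IsHighWeightVector P (T.theta β μ) (T.omegaInv V β (conj v))) ∧
    (wedge v (T.omegaInv V β (conj v)) ≠ 0 → T.theta β μ = μ →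
      Disjoint M (conjSub M) ∧
      -- `W` is irreducible or the direct sum of two isomorphic irreducible submodules
      (LieModule.IsIrreducible ℝ 𝔤 (realPoints (M ⊔ conjSub M)) ∨
        ∃ B₁ B₂ : LieSubmodule ℝ 𝔤 V,
          LieModule.IsIrreducible ℝ 𝔤 B₁ ∧ LieModule.IsIrreducible ℝ 𝔤 B₂ ∧
          Nonempty (B₁ ≃ₗ⁅ℝ,𝔤⁆ B₂) ∧ Disjoint B₁ B₂ ∧
          B₁ ⊔ B₂ = realPoints (M ⊔ conjSub M)) ∧
      ∃ d : ℝ, d ≠ 0 ∧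
        -- `ω_ρ⁻¹ conj(ω_ρ⁻¹) v = d v`
        T.omegaInv V β (conjEnd (T.omegaInv V β) v) = (d : ℂ) • v ∧
        -- the composite of the equivariant maps `M → M̄ → M` determined by
        -- `v ↦ ω_ρ⁻¹ v̄ ↦ ω_ρ⁻¹ conj(ω_ρ⁻¹) v` is `d` times the identity
        (∃ (φ : M →ₗ⁅ℂ, ℂ ⊗[ℝ] 𝔤⁆ conjSub M) (ψ : conjSub M →ₗ⁅ℂ, ℂ ⊗[ℝ] 𝔤⁆ M),
          (φ ⟨v, hvM⟩ : ℂ ⊗[ℝ] V) = T.omegaInv V β (conj v) ∧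
          (ψ (φ ⟨v, hvM⟩) : ℂ ⊗[ℝ] V) = T.omegaInv V β (conjEnd (T.omegaInv V β) v) ∧
          ∀ m : M, ψ (φ m) = (d : ℂ) • m) ∧
        -- for `d > 0`, with `v₁ = v + ω_ρ⁻¹ v̄ / √d` and `v₂ = v - ω_ρ⁻¹ v̄ / √d`
        (0 < d → ∀ v₁ v₂ : ℂ ⊗[ℝ] V,
          v₁ = v + (((Real.sqrt d)⁻¹ : ℝ) : ℂ) • T.omegaInv V β (conj v) →
          v₂ = v - (((Real.sqrt d)⁻¹ : ℝ) : ℂ) • T.omegaInv V β (conj v) →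
          ∃ B₁ B₂ : LieSubmodule ℝ 𝔤 V,
            LieModule.IsIrreducible ℝ 𝔤 B₁ ∧ LieModule.IsIrreducible ℝ 𝔤 B₂ ∧
            Nonempty (B₁ ≃ₗ⁅ℝ,𝔤⁆ B₂) ∧ Disjoint B₁ B₂ ∧
            B₁ ⊔ B₂ = realPoints (M ⊔ conjSub M) ∧
            B₁.toSubmodule = orbitSpan 𝔤 (rePart v₁) ∧
            (imPart v₁ ≠ 0 → B₁.toSubmodule = orbitSpan 𝔤 (imPart v₁)) ∧
            B₂.toSubmodule = orbitSpan 𝔤 (imPart v₂) ∧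
            (rePart v₂ ≠ 0 → B₂.toSubmodule = orbitSpan 𝔤 (rePart v₂))) ∧
        -- for `d < 0`
        (d < 0 → LieModule.IsIrreducible ℝ 𝔤 (realPoints (M ⊔ conjSub M)))) := by
  have hu := hv.omegaInv_conj hβ
  have huM := T.omegaInv_conj_mem_conjSub β hvM
  have hiff := inf_conjSub_eq_bot_iff h𝔠 hP hβ hM hvM hv
  rw [wedge_ne_zero_iff]
  refine ⟨hiff, ⟨conjSub_isIrreducible hM, huM, hu⟩, fun hli hθ => ?_⟩
  obtain ⟨d, hd0, hd⟩ := exists_real_omegaInv_conj_eq h𝔠 hP hβ hM hvM hv hli hθ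
  have hpos := fun h : 0 < d => exists_decomposition_of_pos h𝔠 hP hβ hM hvM hv hli hθ h hd
  have hneg := fun h : d < 0 => realPoints_isIrreducible_of_neg h𝔠 hP hβ hM hvM hv hθ h hd
  refine ⟨disjoint_iff.2 (hiff.2 hli), ?_, d, hd0, hd, ?_, hpos, hneg⟩
  · rcases lt_or_gt_of_ne hd0 with h | h
    · exact Or.inl (hneg h)
    · obtain ⟨B₁, B₂, h1, h2, h3, h4, h5, -⟩ := hpos h _ _ rfl rfl
      exact Or.inr ⟨B₁, B₂, h1, h2, h3, h4, h5⟩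
  · obtain ⟨φ, ψ, hφ, hψ⟩ := exists_hom_comp_eq h𝔠 hP hβ hM hvM hv hli hθ (d : ℂ)
    refine ⟨φ, ψ, hφ, ?_, hψ⟩
    rw [hψ]
    exact hd.symm
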